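/- Let $A$ be a commutative ring with the identity involution which is 1-even, i.e. $2$ is not a zero divisor in $A$ and $a-a^2\in 2A$ for every $a\in A$. Write $A_k=A/kA$ and $R=A[x]$ (with the identity involution). For $u\in R$ let $C(u)$ be the chain complex $2:C(u)_1=R\to C(u)_0=R$, and let $\gamma(u)$ be the chain bundle over $C(u)$ which is the cone of the chain bundle map $(2,2u):(C(u)_1,0)\to(C(u)_0,u)$; its components are $u:C(u)_0\to C(u)^0$, $2u:C(u)_0\to C(u)^1$ and $2u:C(u)_1\to C(u)^1$. For a chain bundle $\gamma$ over $C$, $Q_n(C,\gamma)$ is the twisted quadratic $Q$-group: the group of equivalence classes of $n$-dimensional symmetric structures $(\phi,\theta)$ on $(C,\gamma)$, where $\phi=\{\phi_s\mid s\ge 0\}$ is an $n$-dimensional symmetric cycle of $C$ and $\theta=\{\theta_s\mid s\in\mathbb Z\}$ is an $(n+1)$-dimensional hyperquadratic chain of $C$ with $d\theta=J\phi-\phi_0^{\%}(S^n\gamma)$. Let $N_\gamma:Q_n(C,\gamma)\to Q^n(C)$, $(\phi,\theta)\mapsto\phi$. For chain bundles $(D,\delta)$, $(C,\gamma)$ the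 connecting map component is $$H_{n+1}(D\otimes_R C)\to\widehat Q^{n+1}(C)\to Q_n(C,\gamma),\qquad (f:D^{n+1-*}\to C)\mapsto(0,\widehat f^{\%}(S^{n+1}\delta)).$$ Let $\partial(x)$ be this component for $(D,\delta)=(C(1),\gamma(1))$ and $(C,\gamma)=(C(x),\gamma(x))$, and let $\partial(1):H_{n+1}(C(1)\otimes C(x))\cong H_{n+1}(C(x)\otimes C(1))\to Q_n(C(1),\gamma(1))$ be the transposition followed by the component for $(D,\delta)=(C(x),\gamma(x))$ and $(C,\gamma)=(C(1),\gamma(1))$. There are isomorphisms $H_1(C(1)\otimes_R C(x))\cong A_2[x]$ and $H_0(C(1)\otimes_R C(x))\cong A_2[x]$, given by sending $h$ to the reduction mod $2$ of its component $C(1)^0\to C(x)_1$, respectively $C(1)^0\to C(x)_0$. In terms of these the following hold. For $u\in\{1,x\}$ there are isomorphisms $$Q_{-1}(C(u),\gamma(u))\cong\frac{R}{2R+\{a-a^2u\mid a\in R\}},\qquad Q_0(C(u),\gamma(u))\cong\frac{\{a\in R\mid a-a^2u\in 2R\}}{8R+\{4b-4b^2u\mid b\in R\}},$$ $$\mathrm{im}\big(N_{\gamma(u)}:Q_1(C(u),\gamma(u))\to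 Q^1(C(u))\big)\cong\frac{\{a\in R\mid a-a^2u\in 2R\}}{2R},$$ sending respectively $(\phi,\theta)$ to the component $\theta_0:C^0\to C_0$; $(\phi,\theta)$ with $\phi_s=0$ for $s\ge 1$ and $\theta_s=0$ for $s\ge 0$ to the component $\phi_0:C^0\to C_0$; and $\phi$ to the component $\phi_0:C^0\to C_1$. (i) For $u=1$, writing $a=\sum_i a_ix^i$, there are (well-defined) isomorphisms $$f_{-1}(1):\frac{R}{2R+\{a-a^2\}}\to A_2[x],\quad a\mapsto a_0+\sum_{i\ge 0}\Big(\sum_{j\ge 0}a_{(2i+1)2^j}\Big)x^{i+1},$$ $$f_0(1):\frac{\{a\mid a-a^2\in 2R\}}{8R+\{4b-4b^2\}}\to A_8\oplus A_4[x]\oplus A_2[x],\quad a\mapsto\Big(a_0,\ \sum_{i\ge 0}\Big(\sum_{j\ge 0}\tfrac{a_{(2i+1)2^j}}2\Big)x^i,\ \sum_{k\ge 0}\tfrac{a_{2k+2}}2x^k\Big),$$ $$f_1(1):\frac{\{a\mid a-a^2\in 2R\}}{2R}\to A_2,\quad a\mapsto a_0,$$ where for $a-a^2\in 2R$ the coefficients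 $a_k$ with $k\ge 1$ are (uniquely) divisible by $2$. In terms of these identifications, $\partial(1)$ is given by $$H_1(C(1)\otimes C(x))=A_2[x]\to Q_0(C(1),\gamma(1)),\ c\mapsto(0,2c,0);\qquad H_0(C(1)\otimes C(x))=A_2[x]\to Q_{-1}(C(1),\gamma(1)),\ c\mapsto cx,$$ with $2:A_2[x]\to A_4[x]$ induced by multiplication by $2$. (ii) For $u=x$ there are (well-defined) isomorphisms $$f_{-1}(x):\frac{R}{2R+\{a-a^2x\}}\to A_2[x],\quad a\mapsto\sum_{i\ge 0}\Big(\sum_{j\ge 0}a_{(2i+1)2^j-1}\Big)x^i,$$ $$f_0(x):\frac{\{a\mid a-a^2x\in 2R\}}{8R+\{4b-4b^2x\}}\to A_4[x]\oplus A_2[x],\quad a\mapsto\Big(\sum_{i\ge 0}\Big(\sum_{j\ge 0}\tfrac{a_{(2i+1)2^j-1}}2\Big)x^i,\ \sum_{k\ge 0}\tfrac{a_{2k+1}}2x^k\Big),$$ where for $a-a^2x\in 2R$ all coefficients $a_k$ are (uniquely) divisible by $2$, and the group $\{a\mid a-a^2x\in 2R\}/2R$ is $0$. In terms of these identifications, $\partial(x)$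 is given by $$H_1(C(1)\otimes C(x))=A_2[x]\to Q_0(C(x),\gamma(x)),\ c\mapsto(2c,0);\qquad H_0(C(1)\otimes C(x))=A_2[x]\to Q_{-1}(C(x),\gamma(x)),\ c\mapsto c.$$ -/

import Mathlib

universe u
set_option linter.unusedSimpArgs false

/-- A finite complex of finitely generated free modules with bases over the commutative ring `R` with
the identity involution: `C_r` has basis `ι r`, and `d q r` is the matrix of a map `C_r → C_q`, which
vanishes unless `q + 1 = r`. Dual modules are given the dual bases, so that dual maps are transposed
matrices. -/
structure BasedComplex (R : Type u) [CommRing R] where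
  ι : ℤ → Type
  fin : ∀ r, Fintype (ι r)
  bounded : ∃ N : ℤ, ∀ r, N < |r| → IsEmpty (ι r)
  d : ∀ q r, Matrix (ι q) (ι r) R
  shape : ∀ q r, q + 1 ≠ r → d q r = 0
  d_comp_d : ∀ p q r, d p q * d q r = 0

attribute [instance] BasedComplex.fin

namespace BasedComplex

variable {R : Type u} [CommRing R]

/-- The complex `C^{n-*}`, with `(C^{n-*})_r = C^{n-r}` and differential `(-1)^r d^*`. -/
def dual (C : BasedComplex R) (n : ℤ) : BasedComplex R where
  ι r := C.ι (n - r)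
  fin r := C.fin (n - r)
  bounded := by
    obtain ⟨N, hN⟩ := C.bounded
    refine ⟨N + |n|, fun r hr => hN _ ?_⟩
    have := abs_sub_abs_le_abs_sub r n
    rw [abs_sub_comm] at this
    linarith
  d q r := r.negOnePow • (C.d (n - r) (n - q)).transpose
  shape q r h := by rw [C.shape _ _ (by omega)]; simp
  d_comp_d p q r := by
    simp [← Matrix.transpose_mul, C.d_comp_d]

/-- Families of maps `f p q : D^p → C_q` for all `p, q`, i.e. elements of `D ⊗ C` in all degrees
together; the component `f p q` has degree `p + q` in `D ⊗ C`.

An element `θ = {θ_s | s ∈ ℤ}` of degree `n` of the hyperquadratic complex of `C` has components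
`θ_s : C^{n-r+s} → C_r`; it is encoded as the family of all its components, and `θ_s` is recovered as
the components with `p + q = n + s`. -/
abbrev Fam (D C : BasedComplex R) : Type u := ∀ p q : ℤ, Matrix (C.ι q) (D.ι p) R

/-- The transposition `T : D ⊗ C → C ⊗ D`, on maps `D^p → C_q` the sign `(-1)^(pq)` times the dual. -/
def transp (D C : BasedComplex R) : Fam D C →+ Fam C D :=
  AddMonoidHom.mk' (fun f p q => (p * q).negOnePow • (f q p).transpose)
    (by intro f g; funext p q; simp [Matrix.transpose_add, smul_add])

/-- The differential of `D ⊗ C = Hom(D^{-*}, C)`: `f ↦ d f + (-1)^q f d^*` into `C_q`. -/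
def dV (D C : BasedComplex R) : Fam D C →+ Fam D C :=
  AddMonoidHom.mk'
    (fun f p q => C.d q (q + 1) * f p (q + 1) +
      q.negOnePow • (f (p + 1) q * (D.d p (p + 1)).transpose))
    (by intro f g; funext p q; simp [Matrix.mul_add, Matrix.add_mul, smul_add]; abel)

/-- The differential of the hyperquadratic complex from degree `n` to degree `n - 1`. On the
components `C^p → C_q` with `p + q = n - 1 + s` it is
`d θ_s + (-1)^q θ_s d^* + (-1)^{n+s-1} (θ_{s-1} + (-1)^s T θ_{s-1})`. -/
def dHat (C : BasedComplex R) (n : ℤ) : Fam C C →+ Fam C C :=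
  AddMonoidHom.mk'
    (fun θ p q => dV C C θ p q +
      (p + q).negOnePow • (θ p q + (p + q + 1 - n).negOnePow • transp C C θ p q))
    (by intro f g; funext p q; simp [smul_add]; abel)

theorem transp_apply (D C : BasedComplex R) (f : Fam D C) (p q : ℤ) :
   transp D C f p q = (p * q).negOnePow • (f q p).transpose := rfl
theorem dV_apply (D C : BasedComplex R) (f : Fam D C) (p q : ℤ) :
   dV D C f p q = C.d q (q + 1) * f p (q + 1) +
      q.negOnePow • (f (p + 1) q * (D.d p (p + 1)).transpose) := rfl
theorem dHat_apply (C : BasedComplex R) (n : ℤ) (θ : Fam C C) (p q : ℤ) :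
   dHat C n θ p q = dV C C θ p q +
      (p + q).negOnePow • (θ p q + (p + q + 1 - n).negOnePow • transp C C θ p q) := rfl


theorem transp_transp (D C : BasedComplex R) (f : Fam D C) :
    transp C D (transp D C f) = f := by
  funext p q
  simp [transp_apply, Matrix.transpose_smul, smul_smul, mul_comm q p]

/-- The sign `(-1)^(p+q)` on the component `(p, q)`. -/
def sg (D C : BasedComplex R) : Fam D C →+ Fam D C :=
  AddMonoidHom.mk' (fun f p q => (p + q).negOnePow • f p q)
    (by intro f g; funext p q; simp)

theorem sg_apply (D C : BasedComplex R) (f : Fam D C) (p q : ℤ) :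
   sg D C f p q = (p + q).negOnePow • f p q := rfl

theorem dHat_eq (C : BasedComplex R) (n : ℤ) (θ : Fam C C) :
    dHat C n θ = dV C C θ + sg C C θ - n.negOnePow • transp C C θ := by
  funext p q
  have h : (p + q).negOnePow * (p + q + 1 - n).negOnePow = - n.negOnePow := by
    rw [← Int.negOnePow_add, ← Int.negOnePow_succ, Int.negOnePow_eq_iff]
    exact ⟨p + q - n, by ring⟩
  simp only [dHat_apply, smul_add, smul_smul, h, Pi.sub_apply, Pi.add_apply, Pi.smul_apply,
    sg_apply, Units.neg_smul]
  abel

theorem sg_transp (D C : BasedComplex R) (f : Fam D C) :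
    sg C D (transp D C f) = transp D C (sg D C f) := by
  funext p q
  simp only [sg_apply, transp_apply, Matrix.transpose_smul, smul_smul]
  rw [mul_comm, add_comm]

theorem dV_transp (D C : BasedComplex R) (f : Fam D C) :
    dV C D (transp D C f) = transp D C (dV D C f) := by
  funext p q
  simp only [dV_apply, transp_apply, Matrix.transpose_add, Matrix.transpose_smul,
    Matrix.transpose_mul, Matrix.transpose_transpose, smul_add, Matrix.mul_smul, Matrix.smul_mul,
    smul_smul]
  rw [add_comm]
  congr 2
  · rw [← Int.negOnePow_add, Int.negOnePow_eq_iff]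
    exact ⟨q, by ring⟩
  · rw [← Int.negOnePow_add, Int.negOnePow_eq_iff]
    exact ⟨0, by ring⟩

theorem dV_sg (D C : BasedComplex R) (f : Fam D C) :
    dV D C (sg D C f) = - sg D C (dV D C f) := by
  funext p q
  have h1 : (p + (q + 1)).negOnePow = - (p + q).negOnePow := by
    rw [← add_assoc, Int.negOnePow_succ]
  have h2 : (p + 1 + q).negOnePow = - (p + q).negOnePow := by
    rw [add_right_comm, Int.negOnePow_succ]
  simp only [dV_apply, sg_apply, h1, h2, Matrix.mul_smul, Matrix.smul_mul, smul_add, smul_smul,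
    Pi.neg_apply, Units.neg_smul, neg_add, smul_neg, Matrix.mul_neg, Matrix.neg_mul]
  rw [mul_comm]

theorem sg_sg (D C : BasedComplex R) (f : Fam D C) : sg D C (sg D C f) = f := by
  funext p q
  simp [sg_apply, smul_smul]

theorem dV_dV (D C : BasedComplex R) (f : Fam D C) : dV D C (dV D C f) = 0 := by
  funext p q
  simp only [dV_apply, Matrix.mul_add, Matrix.add_mul, Matrix.mul_smul, Matrix.smul_mul, smul_add,
    smul_smul, Pi.zero_apply]
  rw [← Matrix.mul_assoc, C.d_comp_d, Matrix.mul_assoc (f _ _), ← Matrix.transpose_mul, D.d_comp_d]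
  simp [Int.negOnePow_succ, Matrix.mul_assoc]

theorem smul_smul_self (n : ℤ) {M : Type*} [AddCommGroup M] (x : M) :
    n.negOnePow • n.negOnePow • x = x := by
  simp [smul_smul]

theorem map_usmul {M N : Type*} [AddCommGroup M] [AddCommGroup N] (f : M →+ N) (ε : ℤˣ) (x : M) :
    f (ε • x) = ε • f x := by
  simp only [Units.smul_def, map_zsmul]

theorem dHat_dHat (C : BasedComplex R) (n : ℤ) (θ : Fam C C) :
    dHat C n (dHat C (n + 1) θ) = 0 := by
  simp only [dHat_eq, Int.negOnePow_succ, map_add, map_sub, map_neg, dV_dV, dV_sg, sg_sg, dV_transp,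
    sg_transp, Units.neg_smul, map_usmul, transp_transp, smul_sub, smul_add, smul_neg,
    smul_smul_self]
  abel

section Conj

variable {E C : BasedComplex R}

/-- `Γ ↦ F Γ G^*`. For `F = G` this is the map of hyperquadratic complexes induced by `F : E → C`. -/
def conj (F G : ∀ r, Matrix (C.ι r) (E.ι r) R) : Fam E E →+ Fam C C :=
  AddMonoidHom.mk' (fun Γ p q => F q * Γ p q * (G p).transpose)
    (by intro f g; funext p q; simp [Matrix.mul_add, Matrix.add_mul])

/-- `Γ ↦ X Γ G^*` for a map `X : E → C` of degree one. -/
def hL (X : ∀ r q, Matrix (C.ι q) (E.ι r) R) (G : ∀ r, Matrix (C.ι r) (E.ι r) R) :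
    Fam E E →+ Fam C C :=
  AddMonoidHom.mk' (fun Γ p q => X (q - 1) q * Γ p (q - 1) * (G p).transpose)
    (by intro f g; funext p q; simp [Matrix.mul_add, Matrix.add_mul])

/-- `Γ ↦ ± F Γ X^*` for a map `X : E → C` of degree one. -/
def hR (F : ∀ r, Matrix (C.ι r) (E.ι r) R) (X : ∀ r q, Matrix (C.ι q) (E.ι r) R) :
    Fam E E →+ Fam C C :=
  AddMonoidHom.mk' (fun Γ p q => q.negOnePow • (F q * Γ (p - 1) q * (X (p - 1) p).transpose))
    (by intro f g; funext p q; simp [Matrix.mul_add, Matrix.add_mul])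

/-- `Γ ↦ ± X Γ Y^*` for maps `X, Y : E → C` of degree one. -/
def hM (X Y : ∀ r q, Matrix (C.ι q) (E.ι r) R) : Fam E E →+ Fam C C :=
  AddMonoidHom.mk' (fun Γ p q =>
    (q - 1).negOnePow • (X (q - 1) q * Γ (p - 1) (q - 1) * (Y (p - 1) p).transpose))
    (by intro f g; funext p q; simp [Matrix.mul_add, Matrix.add_mul])

theorem conj_apply (F G : ∀ r, Matrix (C.ι r) (E.ι r) R) (Γ p q) :
  conj F G Γ p q = F q * Γ p q * (G p).transpose := rfl
theorem hL_apply (X : ∀ r q, Matrix (C.ι q) (E.ι r) R) (G : ∀ r, Matrix (C.ι r) (E.ι r) R) (Γ p q) :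
  hL X G Γ p q = X (q - 1) q * Γ p (q - 1) * (G p).transpose := rfl
theorem hR_apply (X : ∀ r q, Matrix (C.ι q) (E.ι r) R) (G : ∀ r, Matrix (C.ι r) (E.ι r) R) (Γ p q) :
  hR G X Γ p q = q.negOnePow • (G q * Γ (p - 1) q * (X (p - 1) p).transpose) := rfl
theorem hM_apply (X Y : ∀ r q, Matrix (C.ι q) (E.ι r) R) (Γ p q) :
  hM X Y Γ p q = (q - 1).negOnePow • (X (q - 1) q * Γ (p - 1) (q - 1) * (Y (p - 1) p).transpose) :=
  rfl

/-- `F : E → C` is a chain map. -/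
def IsChainMap (F : ∀ r, Matrix (C.ι r) (E.ι r) R) : Prop :=
  ∀ q, C.d q (q + 1) * F (q + 1) = F q * E.d q (q + 1)

/-- `X` is a chain homotopy with `d X + X d = δ`. -/
def IsHomotopy (X : ∀ r q, Matrix (C.ι q) (E.ι r) R) (δ : ∀ r, Matrix (C.ι r) (E.ι r) R) : Prop :=
  ∀ q, δ q = C.d q (q + 1) * X q (q + 1) + X (q - 1) q * E.d (q - 1) q

theorem IsHomotopy.d_mul {X : ∀ r q, Matrix (C.ι q) (E.ι r) R} {δ : ∀ r, Matrix (C.ι r) (E.ι r) R}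
    (h : IsHomotopy X δ) (q : ℤ) :
    C.d q (q + 1) * X q (q + 1) = δ q - X (q - 1) q * E.d (q - 1) q := by
  rw [h q]; abel

variable {F G δ δ' : ∀ r, Matrix (C.ι r) (E.ι r) R} {X Y : ∀ r q, Matrix (C.ι q) (E.ι r) R}

theorem dV_conj (hF : IsChainMap F) (hG : IsChainMap G) (Γ : Fam E E) :
    dV C C (conj F G Γ) = conj F G (dV E E Γ) := by
  funext p q
  have e : (G (p + 1)).transpose * (C.d p (p + 1)).transpose =
      (E.d p (p + 1)).transpose * (G p).transpose := by
    rw [← Matrix.transpose_mul, hG p, Matrix.transpose_mul]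
  simp only [dV_apply, conj_apply, Matrix.mul_add, Matrix.add_mul, Matrix.mul_smul,
    Matrix.smul_mul]
  rw [Matrix.mul_assoc _ _ (C.d p (p + 1)).transpose, e, ← Matrix.mul_assoc, ← Matrix.mul_assoc,
    hF q]
  simp only [Matrix.mul_assoc]

theorem transp_conj (Γ : Fam E E) :
    transp C C (conj F G Γ) = conj G F (transp E E Γ) := by
  funext p q
  simp only [transp_apply, conj_apply, Matrix.transpose_mul, Matrix.transpose_transpose,
    Matrix.mul_smul, Matrix.smul_mul, Matrix.mul_assoc]

theorem dV_hL (hX : IsHomotopy X δ) (hG : IsChainMap G) (Γ : Fam E E) :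
    dV C C (hL X G Γ) = conj δ G Γ - hL X G (dV E E Γ) := by
  funext p q
  have e : (G (p + 1)).transpose * (C.d p (p + 1)).transpose =
      (E.d p (p + 1)).transpose * (G p).transpose := by
    rw [← Matrix.transpose_mul, hG p, Matrix.transpose_mul]
  have e2 : C.d q (q + 1) * (X (q + 1 - 1) (q + 1) * Γ p (q + 1 - 1)) =
     δ q * Γ p q - X (q - 1) q * (E.d (q - 1) (q - 1 + 1) * Γ p (q - 1 + 1)) := by
    rw [show q + 1 - 1 = q by ring, show q - 1 + 1 = q by ring, ← Matrix.mul_assoc, hX.d_mul,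
      Matrix.sub_mul, Matrix.mul_assoc]
  have e3 : q.negOnePow = - (q - 1).negOnePow := by
    rw [← Int.negOnePow_succ, show q - 1 + 1 = q by ring]
  simp only [dV_apply, conj_apply, hL_apply, Pi.sub_apply, Matrix.mul_add, Matrix.add_mul,
    Matrix.mul_smul, Matrix.smul_mul]
  rw [Matrix.mul_assoc _ _ (C.d p (p + 1)).transpose, e, ← Matrix.mul_assoc (C.d q (q + 1)), e2, e3]
  simp only [Matrix.mul_assoc, Matrix.sub_mul, Units.neg_smul]
  abel

theorem transp_hL (Γ : Fam E E) :
    transp C C (hL X G Γ) = hR G X (transp E E Γ) := by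
  funext p q
  have e : (p * q).negOnePow = q.negOnePow * ((p - 1) * q).negOnePow := by
    rw [← Int.negOnePow_add]; ring_nf
  simp only [transp_apply, hL_apply, hR_apply, Matrix.transpose_mul, Matrix.transpose_transpose,
    Matrix.mul_smul, Matrix.smul_mul, Matrix.mul_assoc, smul_smul, e]

theorem transp_hR (Γ : Fam E E) :
    transp C C (hR G X Γ) = hL X G (transp E E Γ) := by
  rw [← transp_transp _ _ (hL _ _ _), transp_hL, transp_transp]

theorem dV_hR (hX : IsHomotopy X δ) (hG : IsChainMap G) (Γ : Fam E E) :
    dV C C (hR G X Γ) = conj G δ Γ - hR G X (dV E E Γ) := by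
  have h := dV_hL hX hG (transp E E Γ)
  have h2 := congrArg (transp C C) h
  simpa only [map_sub, transp_conj, transp_hL, transp_transp, ← dV_transp] using h2

theorem transp_hM (Γ : Fam E E) :
    transp C C (hM X Y Γ) = - hM Y X (transp E E Γ) := by
  funext p q
  have e : (p * q).negOnePow * (p - 1).negOnePow =
      - ((q - 1).negOnePow * ((p - 1) * (q - 1)).negOnePow) := by
    rw [← Int.negOnePow_add, ← Int.negOnePow_add, ← Int.negOnePow_succ, Int.negOnePow_eq_iff]
    exact ⟨p - 1, by ring⟩
  simp only [transp_apply, hM_apply, Matrix.transpose_mul, Matrix.transpose_transpose,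
    Matrix.mul_smul, Matrix.smul_mul, Matrix.mul_assoc, smul_smul, e, Matrix.transpose_smul,
    Pi.neg_apply, Units.neg_smul]

theorem dV_hM (hX : IsHomotopy X δ) (hY : IsHomotopy Y δ') (Γ : Fam E E) :
    dV C C (hM X Y Γ) = hR δ Y Γ - hL X δ' Γ + hM X Y (dV E E Γ) := by
  funext p q
  have e : (Y p (p + 1)).transpose * (C.d p (p + 1)).transpose =
      (δ' p).transpose - (E.d (p - 1) p).transpose * (Y (p - 1) p).transpose := by
    rw [← Matrix.transpose_mul, ← Matrix.transpose_mul, ← Matrix.transpose_sub, hY.d_mul]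
  have e2 : C.d q (q + 1) * (X (q + 1 - 1) (q + 1) * Γ (p - 1) (q + 1 - 1)) =
     δ q * Γ (p - 1) q - X (q - 1) q * (E.d (q - 1) (q - 1 + 1) * Γ (p - 1) (q - 1 + 1)) := by
    rw [show q + 1 - 1 = q by ring, show q - 1 + 1 = q by ring, ← Matrix.mul_assoc, hX.d_mul,
      Matrix.sub_mul, Matrix.mul_assoc]
  have e3 : q.negOnePow = - (q - 1).negOnePow := by
    rw [← Int.negOnePow_succ, show q - 1 + 1 = q by ring]
  have e4 : (q + 1 - 1).negOnePow = q.negOnePow := by rw [show q + 1 - 1 = q by ring]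
  have e5 : Γ (p + 1 - 1) (q - 1) * ((Y (p + 1 - 1) (p + 1)).transpose * (C.d p (p + 1)).transpose)
      = Γ p (q - 1) * (δ' p).transpose -
        Γ (p - 1 + 1) (q - 1) * ((E.d (p - 1) (p - 1 + 1)).transpose * (Y (p - 1) p).transpose) := by
    rw [show p + 1 - 1 = p by ring, show p - 1 + 1 = p by ring, e, Matrix.mul_sub]
  simp only [dV_apply, hM_apply, hR_apply, hL_apply, Pi.sub_apply, Pi.add_apply, Matrix.mul_add,
    Matrix.add_mul, Matrix.mul_smul, Matrix.smul_mul, e4, smul_smul, smul_add]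
  rw [← Matrix.mul_assoc (C.d q (q + 1)), e2]
  simp only [Matrix.mul_assoc, e5, Matrix.sub_mul, Matrix.mul_sub, e3, smul_sub, smul_smul,
    Units.neg_smul, neg_mul, Int.units_mul_self, one_smul]
  abel

theorem sg_conj (Γ : Fam E E) : sg C C (conj F G Γ) = conj F G (sg E E Γ) := by
  funext p q
  simp only [sg_apply, conj_apply, Matrix.mul_smul, Matrix.smul_mul]

theorem sg_hL (Γ : Fam E E) : sg C C (hL X G Γ) = - hL X G (sg E E Γ) := by
  funext p q
  have e : (p + q).negOnePow = - (p + (q - 1)).negOnePow := by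
    rw [← Int.negOnePow_succ]; ring_nf
  simp only [sg_apply, hL_apply, Matrix.mul_smul, Matrix.smul_mul, e, Pi.neg_apply, Units.neg_smul]

theorem sg_hR (Γ : Fam E E) : sg C C (hR G X Γ) = - hR G X (sg E E Γ) := by
  rw [← transp_transp _ _ (hR _ _ Γ), transp_hR, sg_transp, sg_hL, map_neg, transp_hL, sg_transp,
    transp_transp]

theorem sg_hM (Γ : Fam E E) : sg C C (hM X Y Γ) = hM X Y (sg E E Γ) := by
  funext p q
  have e : (p - 1 + (q - 1)).negOnePow = (p + q).negOnePow := by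
    rw [Int.negOnePow_eq_iff]; exact ⟨-1, by ring⟩
  simp only [sg_apply, hM_apply, Matrix.mul_smul, Matrix.smul_mul, e]
  rw [smul_comm]


variable {F' G' F'' : ∀ r, Matrix (C.ι r) (E.ι r) R} {X' Y' : ∀ r q, Matrix (C.ι q) (E.ι r) R}

theorem conj_add_left (Γ : Fam E E) : conj (F + F') G Γ = conj F G Γ + conj F' G Γ := by
  funext p q; simp [conj_apply, Matrix.add_mul]
theorem conj_add_right (Γ : Fam E E) : conj F (G + G') Γ = conj F G Γ + conj F G' Γ := by
  funext p q; simp [conj_apply, Matrix.mul_add]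
theorem conj_neg_left (Γ : Fam E E) : conj (-F) G Γ = - conj F G Γ := by
  funext p q; simp [conj_apply]
theorem conj_neg_right (Γ : Fam E E) : conj F (-G) Γ = - conj F G Γ := by
  funext p q; simp [conj_apply]
theorem conj_zero_left (Γ : Fam E E) : conj (0 : ∀ r, Matrix (C.ι r) (E.ι r) R) G Γ = 0 := by
  funext p q; simp [conj_apply]
theorem conj_zero_right (Γ : Fam E E) : conj F (0 : ∀ r, Matrix (C.ι r) (E.ι r) R) Γ = 0 := by
  funext p q; simp [conj_apply]
theorem hL_add_left (Γ : Fam E E) : hL (X + X') G Γ = hL X G Γ + hL X' G Γ := by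
  funext p q; simp [hL_apply, Matrix.add_mul]
theorem hL_add_right (Γ : Fam E E) : hL X (G + G') Γ = hL X G Γ + hL X G' Γ := by
  funext p q; simp [hL_apply, Matrix.mul_add]
theorem hR_add_left (Γ : Fam E E) : hR (G + G') X Γ = hR G X Γ + hR G' X Γ := by
  funext p q; simp [hR_apply, Matrix.add_mul]
theorem hR_add_right (Γ : Fam E E) : hR G (X + X') Γ = hR G X Γ + hR G X' Γ := by
  funext p q; simp [hR_apply, Matrix.mul_add]
theorem hM_add_left (Γ : Fam E E) : hM (X + X') Y Γ = hM X Y Γ + hM X' Y Γ := by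
  funext p q; simp [hM_apply, Matrix.add_mul]
theorem hM_add_right (Γ : Fam E E) : hM X (Y + Y') Γ = hM X Y Γ + hM X Y' Γ := by
  funext p q; simp [hM_apply, Matrix.mul_add]

/-- For a chain homotopy `X : F ≃ F'` and a hyperquadratic cycle `Γ` of degree `n`, the standard element
of degree `n + 1` whose boundary is `F'^%(Γ) - F^%(Γ)`. -/
def homotopyTerm (n : ℤ) (Γ : Fam E E) (X : ∀ r q, Matrix (C.ι q) (E.ι r) R)
    (F F' : ∀ r, Matrix (C.ι r) (E.ι r) R) : Fam C C :=
  hL X F Γ + hR F' X Γ + n.negOnePow • hM X X (transp E E Γ)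

/-- For chain maps `F, F'` and a hyperquadratic cycle `Γ` of degree `n`, the standard element of degree
`n + 1` whose boundary is `F^%(Γ) + F'^%(Γ) - (F + F')^%(Γ)`; up to sign its only components
are `F Γ_{s+1} F'^*` in position `s`. -/
def sumTerm (n : ℤ) (Γ : Fam E E) (F F' : ∀ r, Matrix (C.ι r) (E.ι r) R) : Fam C C :=
  - (n.negOnePow • conj F F' (transp E E Γ))

variable {n : ℤ} {Γ : Fam E E}

theorem dV_cocycle (hΓ : dHat E n Γ = 0) : dV E E Γ = n.negOnePow • transp E E Γ - sg E E Γ := by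
  rw [dHat_eq] at hΓ
  rw [← sub_eq_zero, ← hΓ]; abel

theorem eps_two (n : ℤ) : (n + 2).negOnePow = n.negOnePow := by
  rw [Int.negOnePow_eq_iff]; exact ⟨1, by ring⟩

theorem dHat_conj (hF : IsChainMap F) (Γ : Fam E E) :
    dHat C n (conj F F Γ) = conj F F (dHat E n Γ) := by
  simp only [dHat_eq, dV_conj hF hF, sg_conj, transp_conj, map_add, map_sub, map_usmul]

theorem dHat_sumTerm (hΓ : dHat E n Γ = 0) (hF : IsChainMap F) (hG : IsChainMap G) :
    dHat C (n + 1) (sumTerm n Γ F G) = - (conj F G Γ + conj G F Γ) := by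
  simp only [sumTerm, dHat_eq, map_neg, map_usmul, dV_conj hF hG, sg_conj, transp_conj, dV_transp,
    dV_cocycle hΓ, sg_transp, map_sub, transp_transp, Int.negOnePow_succ, Units.neg_smul, smul_sub,
    smul_neg, smul_smul_self]
  rcases Int.units_eq_one_or n.negOnePow with h | h <;>
  simp only [h, one_smul, Units.neg_smul, neg_neg] <;>
  abel

theorem dHat_homotopyTerm (hΓ : dHat E n Γ = 0) (hF : IsChainMap F) (hF' : IsChainMap (F + δ))
    (hX : IsHomotopy X δ) :
    dHat C (n + 1) (homotopyTerm n Γ X F (F + δ)) = conj (F + δ) (F + δ) Γ - conj F F Γ := by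
  simp only [homotopyTerm, dHat_eq, map_neg, map_add, map_usmul, dV_hL hX hF, dV_hR hX hF',
    dV_hM hX hX, sg_hL, sg_hR, sg_hM, transp_hL, transp_hR, transp_hM, dV_transp,
    dV_cocycle hΓ, sg_transp, map_sub, transp_transp, Int.negOnePow_succ, Units.neg_smul, smul_sub,
    smul_add, smul_neg, smul_smul_self]
  simp only [conj_add_left, conj_add_right, hR_add_left, hL_add_right, neg_neg, neg_sub, smul_add,
    neg_add, smul_smul_self]
  abel

theorem homotopyTerm_trans (hΓ : dHat E n Γ = 0) 
    (hX : IsHomotopy X δ) (hY : IsHomotopy Y δ') :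
    homotopyTerm n Γ (X + Y) F (F + δ + δ') = homotopyTerm n Γ X F (F + δ) +
      homotopyTerm n Γ Y (F + δ) (F + δ + δ') + dHat C (n + 2) (hM Y X Γ) := by
  simp only [homotopyTerm, dHat_eq, map_neg, map_add, map_usmul, dV_hM hY hX, sg_hM, transp_hM,
    dV_cocycle hΓ, map_sub, eps_two, smul_add, smul_neg, hL_add_left, hL_add_right,
    hR_add_left, hR_add_right, hM_add_left, hM_add_right]
  abel

set_option maxHeartbeats 1000000 in
theorem homotopyTerm_add (hΓ : dHat E n Γ = 0) (hF : IsChainMap (F + δ)) (hG : IsChainMap G)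
    (hX : IsHomotopy X δ) (hY : IsHomotopy Y δ') :
    homotopyTerm n Γ (X + Y) (F + G) (F + δ + (G + δ')) + sumTerm n Γ (F + δ) (G + δ')
      - sumTerm n Γ F G = homotopyTerm n Γ X F (F + δ) + homotopyTerm n Γ Y G (G + δ') +
      dHat C (n + 2) (hM Y X Γ - n.negOnePow • (hL X G (transp E E Γ) +
        hR (F + δ) Y (transp E E Γ))) := by
  simp only [homotopyTerm, sumTerm, dHat_eq, map_neg, map_add, map_usmul, dV_hL hX hG, dV_hR hY hF,
    dV_hM hY hX, sg_hL, sg_hR, sg_hM, transp_hL, transp_hR, transp_hM, dV_transp,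
    dV_cocycle hΓ, sg_transp, map_sub, transp_transp, eps_two]
  generalize hF2 : F + δ = F1
  subst hF2
  rcases Int.units_eq_one_or n.negOnePow with h | h <;>
  simp only [h, one_smul, Units.neg_smul, neg_neg, conj_add_left, conj_add_right, hR_add_left,
    hR_add_right, hL_add_left, hL_add_right, hM_add_left, hM_add_right] <;>
  abel

theorem sumTerm_comm (hΓ : dHat E n Γ = 0) (hF : IsChainMap F) (hG : IsChainMap G) :
    dHat C (n + 2) (- conj F G Γ) = sumTerm n Γ F G - sumTerm n Γ G F := by
  simp only [sumTerm, dHat_eq, map_neg, dV_conj hF hG, sg_conj, transp_conj,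
    dV_cocycle hΓ, map_sub, map_usmul, eps_two, smul_neg]
  abel

end Conj

section Chain

variable {D C : BasedComplex R}

/-- The maps `D^{n-r} → C_r` in the family `f`, as a map `D^{n-*} → C`. For a symmetric structure `φ` of
degree `n` this is `φ_0 : C^{n-*} → C`. -/
def chain (n : ℤ) (f : Fam D C) (r : ℤ) : Matrix (C.ι r) ((D.dual n).ι r) R := f (n - r) r

/-- The maps `D^{n-r} → C_{r+1}` in the family `x`, as a map `D^{n-*} → C` of degree one. -/
def homot (n : ℤ) (x : Fam D C) (r q : ℤ) : Matrix (C.ι q) ((D.dual n).ι r) R := x (n - r) q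

theorem isChainMap_chain {n : ℤ} {f : Fam D C} (h : ∀ p q, p + q + 1 = n → dV D C f p q = 0) :
    IsChainMap (chain n f) := by
  intro q
  have key : ∀ p p', p + 1 = p' → p + q + 1 = n →
      C.d q (q + 1) * f p (q + 1) = f p' q * ((q + 1).negOnePow • (D.d p p').transpose) := by
    rintro p _ rfl hp
    have := h p q hp
    rw [dV_apply] at this
    rw [eq_neg_of_add_eq_zero_left this, Int.negOnePow_succ, Matrix.mul_smul, Units.neg_smul]
  exact key (n - (q + 1)) (n - q) (by ring) (by ring)

theorem isHomotopy_homot {n : ℤ} {f x : Fam D C} (h : ∀ p q, p + q = n → dV D C x p q = f p q) :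
    IsHomotopy (homot n x) (chain n f) := by
  intro q
  have key : ∀ p p', p + 1 = p' → p + q = n →
      f p q = C.d q (q + 1) * x p (q + 1) + x p' q * (q.negOnePow • (D.d p p').transpose) := by
    rintro p _ rfl hp
    rw [← h p q hp, dV_apply, Matrix.mul_smul]
  have := key (n - q) (n - (q - 1)) (by ring) (by ring)
  rw [show chain n f q = f (n - q) q from rfl, this]
  simp only [dual, homot]
  rfl

end Chain

/-- The `n`-fold suspension `S^n γ` in degree `n` of the hyperquadratic complex of `C^{n-*}`, of the
family `g a b : C_a → C^b` of components of a family `γ` in degree `0` for `C^{-*}`. -/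
def susp (C : BasedComplex R) (n : ℤ) (g : ∀ a b : ℤ, Matrix (C.ι b) (C.ι a) R) :
    Fam (C.dual n) (C.dual n) :=
  fun p q => (n * (n - q)).negOnePow • g (n - p) (n - q)

/-- A chain bundle `γ` over `C`: a hyperquadratic cycle of degree `0` of `C^{-*}`. The component
`γ_s : C_a → C^b`, with `s = - a - b`, is `g a b`. -/
structure ChainBundle (C : BasedComplex R) where
  g : ∀ a b : ℤ, Matrix (C.ι b) (C.ι a) R
  cocycle : dHat (C.dual 0) 0 (susp C 0 g) = 0

theorem dHat_susp_apply (C : BasedComplex R) (n : ℤ) (g : ∀ a b : ℤ, Matrix (C.ι b) (C.ι a) R)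
    (p q : ℤ) : dHat (C.dual n) n (susp C n g) p q = (n * (n - q)).negOnePow •
      ((n - q + 1).negOnePow • ((C.d (n - (q + 1)) (n - q)).transpose * g (n - p) (n - (q + 1))) +
      (n - p + (n - q) + 1).negOnePow • (g (n - (p + 1)) (n - q) * C.d (n - (p + 1)) (n - p)) +
      (n - p + (n - q)).negOnePow • g (n - p) (n - q) +
      ((n - p) * (n - q) + 1).negOnePow • (g (n - q) (n - p)).transpose) := by
  change ((q + 1).negOnePow • (C.d (n - (q + 1)) (n - q)).transpose) *
        ((n * (n - (q + 1))).negOnePow • g (n - p) (n - (q + 1))) +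
      q.negOnePow • (((n * (n - q)).negOnePow • g (n - (p + 1)) (n - q)) *
        ((p + 1).negOnePow • (C.d (n - (p + 1)) (n - p)).transpose).transpose) +
      (p + q).negOnePow • ((n * (n - q)).negOnePow • g (n - p) (n - q) +
        (p + q + 1 - n).negOnePow • (p * q).negOnePow •
          ((n * (n - p)).negOnePow • g (n - q) (n - p)).transpose) = _
  simp only [Matrix.transpose_smul, Matrix.transpose_transpose, Matrix.mul_smul, Matrix.smul_mul,
    smul_add, smul_smul, ← Int.negOnePow_add, ← add_assoc]
  have aux : ∀ k l : ℤ, ∀ m : ℤ, k - l = m + m → k.negOnePow = l.negOnePow := by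
    intro k l m h
    rw [Int.negOnePow_eq_iff, h]
    exact ⟨m, rfl⟩
  obtain ⟨e, he⟩ := Int.even_mul_succ_self n
  have add4 : ∀ {M : Type u} [AddCommGroup M] {a b c d a' b' c' d' : M}, a = a' → b = b' → c = c' →
      d = d' → a + b + c + d = a' + b' + c' + d' := by
    rintro M _ a b c d _ _ _ _ rfl rfl rfl rfl
    rfl
  refine add4 (M := Matrix (C.ι (n - q)) (C.ι (n - p)) R) ?_ ?_ ?_ ?_
  · exact congrArg (· • _) (aux _ _ (q - n) (by ring))
  · exact congrArg (· • _) (aux _ _ (p + q - n) (by ring))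
  · exact congrArg (· • _) (aux _ _ (p + q - n) (by ring))
  · exact congrArg (· • _) (aux _ _ (p + q + n * q - e) (by linear_combination - he))

theorem ChainBundle.dHat_susp {C : BasedComplex R} (γ : ChainBundle C) (n : ℤ) :
    dHat (C.dual n) n (susp C n γ.g) = 0 := by
  have key : ∀ a b a' b' : ℤ, a' = a - 1 → b' = b - 1 →
      (b + 1).negOnePow • ((C.d b' b).transpose * γ.g a b') +
      (a + b + 1).negOnePow • (γ.g a' b * C.d a' a) +
      (a + b).negOnePow • γ.g a b + (a * b + 1).negOnePow • (γ.g b a).transpose = 0 := by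
    intro a b a' b' ha hb
    obtain ⟨p, rfl⟩ : ∃ p, a = 0 - p := ⟨-a, by ring⟩
    obtain ⟨q, rfl⟩ : ∃ q, b = 0 - q := ⟨-b, by ring⟩
    obtain rfl : a' = 0 - (p + 1) := by rw [ha]; ring
    obtain rfl : b' = 0 - (q + 1) := by rw [hb]; ring
    have h := congrFun (congrFun γ.cocycle p) q
    rw [dHat_susp_apply] at h
    simp only [zero_mul, Int.negOnePow_zero, one_smul] at h
    exact h
  funext p q
  rw [dHat_susp_apply, key (n - p) (n - q) _ _ (by ring) (by ring), smul_zero]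
  rfl

section QGroups

variable (C : BasedComplex R)

/-- The symmetric complex in degree `n`: families `{φ_s | s ≥ 0}`, included in the hyperquadratic
complex by setting `φ_s = 0` for `s < 0`. -/
def symChains (n : ℤ) : AddSubgroup (Fam C C) where
  carrier := {φ | ∀ p q, p + q < n → φ p q = 0}
  zero_mem' := fun _ _ _ => rfl
  add_mem' := by
    intro a b ha hb p q h
    simp [ha p q h, hb p q h]
  neg_mem' := by
    intro a ha p q h
    simp [ha p q h]

def symCycles (n : ℤ) : AddSubgroup (Fam C C) := symChains C n ⊓ (dHat C n).ker

def symBoundaries (n : ℤ) : AddSubgroup (Fam C C) := (symChains C (n + 1)).map (dHat C (n + 1))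

/-- The symmetric group `Q^n(C)`. -/
abbrev SymQ (n : ℤ) : Type u := symCycles C n ⧸ (symBoundaries C n).addSubgroupOf (symCycles C n)

/-- The hyperquadratic group `Q̂^n(C)`. -/
abbrev HatQ (n : ℤ) : Type u :=
  (dHat C n).ker ⧸ ((dHat C (n + 1)).range).addSubgroupOf (dHat C n).ker

end QGroups

section Tensor

variable (D C : BasedComplex R)

/-- The degree `n` part of `D ⊗ C`. -/
def tensorChains (n : ℤ) : AddSubgroup (Fam D C) where
  carrier := {f | ∀ p q, p + q ≠ n → f p q = 0}
  zero_mem' := fun _ _ _ => rfl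
  add_mem' := by
    intro a b ha hb p q h
    simp [ha p q h, hb p q h]
  neg_mem' := by
    intro a ha p q h
    simp [ha p q h]

def tensorCycles (n : ℤ) : AddSubgroup (Fam D C) := tensorChains D C n ⊓ (dV D C).ker

def tensorBoundaries (n : ℤ) : AddSubgroup (Fam D C) := (tensorChains D C (n + 1)).map (dV D C)

/-- The homology group `H_n(D ⊗ C)`. -/
abbrev TensorH (n : ℤ) : Type u :=
  tensorCycles D C n ⧸ (tensorBoundaries D C n).addSubgroupOf (tensorCycles D C n)

variable {D C}

theorem transp_mem_chains {n : ℤ} {f : Fam D C} (hf : f ∈ tensorChains D C n) :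
    transp D C f ∈ tensorChains C D n := by
  intro p q h
  rw [transp_apply, hf q p (by omega)]
  simp

theorem transp_mem_cycles {n : ℤ} {f : Fam D C} (hf : f ∈ tensorCycles D C n) :
    transp D C f ∈ tensorCycles C D n := by
  refine ⟨transp_mem_chains hf.1, ?_⟩
  have h : dV D C f = 0 := hf.2
  change dV C D (transp D C f) = 0
  rw [dV_transp, h, map_zero]

/-- The transposition isomorphism `H_n(D ⊗ C) → H_n(C ⊗ D)`. -/
def tensorSwap (n : ℤ) : TensorH D C n →+ TensorH C D n :=
  QuotientAddGroup.map _ _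
    (((transp D C).comp (tensorCycles D C n).subtype).codRestrict (tensorCycles C D n)
      (fun f => transp_mem_cycles f.2))
    (by
      rintro ⟨f, hf⟩ ⟨x, hx, hxf⟩
      refine ⟨transp D C x, transp_mem_chains hx, ?_⟩
      rw [dV_transp, hxf]
      rfl)

end Tensor

section HatMap

variable {D C : BasedComplex R}

/-- `f^%(S^n γ)` for `f : D^{n-*} → C` and a chain bundle `γ` over `D`. -/
def hatMap (γ : ChainBundle D) (n : ℤ) (f : Fam D C) : Fam C C :=
  conj (chain n f) (chain n f) (susp D n γ.g)

theorem hatMap_add (γ : ChainBundle D) (n : ℤ) (f f' : Fam D C) :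
    hatMap γ n (f + f') = hatMap γ n f + hatMap γ n f' +
      (conj (chain n f) (chain n f') (susp D n γ.g) +
        conj (chain n f') (chain n f) (susp D n γ.g)) := by
  have h : chain n (f + f') = chain n f + chain n f' := rfl
  simp only [hatMap, h, conj_add_left, conj_add_right]
  abel

theorem hatMap_mem (γ : ChainBundle D) {n : ℤ} {f : Fam D C}
    (h : IsChainMap (chain n f)) : hatMap γ n f ∈ (dHat C n).ker := by
  rw [AddMonoidHom.mem_ker, hatMap, dHat_conj h, γ.dHat_susp, map_zero]

theorem isChainMap_of_mem {n : ℤ} {f : Fam D C} (hf : f ∈ tensorCycles D C n) :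
    IsChainMap (chain n f) :=
  isChainMap_chain fun p q _ => congrFun (congrFun hf.2 p) q

/-- The map `H_n(D ⊗ C) → Q̂^n(C)`, `(f : D^{n-*} → C) ↦ f^%(S^n γ)`, for a chain bundle `γ`
over `D`. -/
def hatPush (γ : ChainBundle D) (C : BasedComplex R) (n : ℤ) : TensorH D C n →+ HatQ C n :=
  QuotientAddGroup.lift _
    (AddMonoidHom.mk' (fun f : tensorCycles D C n =>
        ((⟨hatMap γ n f.1, hatMap_mem γ (isChainMap_of_mem f.2)⟩ : (dHat C n).ker) : HatQ C n))
      (by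
        intro f f'
        rw [← QuotientAddGroup.mk_add, eq_comm, QuotientAddGroup.eq]
        refine ⟨- sumTerm n (susp D n γ.g) (chain n f.1) (chain n f'.1), ?_⟩
        rw [map_neg, dHat_sumTerm (γ.dHat_susp n) (isChainMap_of_mem f.2) (isChainMap_of_mem f'.2)]
        change _ = - (hatMap γ n f.1 + hatMap γ n f'.1) + hatMap γ n (f.1 + f'.1)
        rw [hatMap_add]
        abel))
    (by
      rintro ⟨f, hf⟩ ⟨x, hx, hxf⟩
      rw [AddMonoidHom.mem_ker, AddMonoidHom.mk'_apply, QuotientAddGroup.eq_zero_iff]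
      have h0 : IsChainMap (chain n (0 : Fam D C)) := isChainMap_of_mem (zero_mem _)
      have hX : IsHomotopy (homot n x) (chain n f) :=
        isHomotopy_homot fun p q _ => congrFun (congrFun hxf p) q
      have e : chain n (0 : Fam D C) + chain n f = chain n f := by
        change chain n (0 + f) = _
        rw [zero_add]
      refine ⟨homotopyTerm n (susp D n γ.g) (homot n x) (chain n 0) (chain n 0 + chain n f), ?_⟩
      rw [dHat_homotopyTerm (γ.dHat_susp n) h0 (by rw [e]; exact isChainMap_of_mem hf) hX, e,
        show chain n (0 : Fam D C) = 0 from rfl, conj_zero_left, sub_zero]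
      rfl)

end HatMap

section Twisted

variable {C : BasedComplex R}

/-- An `n`-dimensional symmetric structure `(φ, θ)` on the chain bundle `γ` over `C`: a symmetric
cycle `φ` of degree `n`, and `θ` of degree `n + 1` with `dθ = J φ - (φ_0)^%(S^n γ)`. -/
@[ext]
structure TwStr (γ : ChainBundle C) (n : ℤ) where
  φ : Fam C C
  θ : Fam C C
  φ_mem : φ ∈ symCycles C n
  dθ : dHat C (n + 1) θ = φ - hatMap γ n φ

namespace TwStr

variable {γ : ChainBundle C} {n : ℤ}

theorem isChainMap_of_sym {φ : Fam C C} (h : φ ∈ symCycles C n) : IsChainMap (chain n φ) := by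
  refine isChainMap_chain fun p q hpq => ?_
  have h1 := congrFun (congrFun (show dHat C n φ = 0 from h.2) p) q
  rw [dHat_apply, transp_apply, h.1 p q (by omega), h.1 q p (by omega)] at h1
  simpa using h1

theorem isHomotopy_of_sym {φ ξ : Fam C C} (hξ : ξ ∈ symChains C (n + 1))
    (h : dHat C (n + 1) ξ = φ) : IsHomotopy (homot n ξ) (chain n φ) := by
  refine isHomotopy_homot fun p q hpq => ?_
  have h1 := congrFun (congrFun h p) q
  rw [dHat_apply, transp_apply, hξ p q (by omega), hξ q p (by omega)] at h1
  simpa using h1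

abbrev cross (γ : ChainBundle C) (n : ℤ) (φ φ' : Fam C C) : Fam C C :=
  sumTerm n (susp C n γ.g) (chain n φ) (chain n φ')

theorem cross_add_left (φ φ' φ'' : Fam C C) :
    cross γ n (φ + φ') φ'' = cross γ n φ φ'' + cross γ n φ' φ'' := by
  have h : chain n (φ + φ') = chain n φ + chain n φ' := rfl
  simp only [cross, sumTerm, h, conj_add_left, smul_add, neg_add]

theorem cross_add_right (φ φ' φ'' : Fam C C) :
    cross γ n φ (φ' + φ'') = cross γ n φ φ' + cross γ n φ φ'' := by
  have h : chain n (φ' + φ'') = chain n φ' + chain n φ'' := rfl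
  simp only [cross, sumTerm, h, conj_add_right, smul_add, neg_add]

theorem cross_neg_left (φ φ' : Fam C C) : cross γ n (-φ) φ' = - cross γ n φ φ' := by
  have h : chain n (-φ) = - chain n φ := rfl
  simp only [cross, sumTerm, h, conj_neg_left, smul_neg]

theorem cross_zero_left (φ : Fam C C) : cross γ n 0 φ = 0 := by
  have h : chain n (0 : Fam C C) = 0 := rfl
  simp only [cross, sumTerm, h, conj_zero_left, smul_zero, neg_zero]

theorem cross_zero_right (φ : Fam C C) : cross γ n φ 0 = 0 := by
  have h : chain n (0 : Fam C C) = 0 := rfl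
  simp only [cross, sumTerm, h, conj_zero_right, smul_zero, neg_zero]

theorem hatMap_neg (φ : Fam C C) : hatMap γ n (-φ) = hatMap γ n φ := by
  have h : chain n (-φ) = - chain n φ := rfl
  simp only [hatMap, h, conj_neg_left, conj_neg_right, neg_neg]

theorem hatMap_zero : hatMap γ n (0 : Fam C C) = 0 := by
  have h : chain n (0 : Fam C C) = 0 := rfl
  simp only [hatMap, h, conj_zero_left]

theorem dHat_cross {φ φ' : Fam C C} (h : φ ∈ symCycles C n) (h' : φ' ∈ symCycles C n) :
    dHat C (n + 1) (cross γ n φ φ') = hatMap γ n φ + hatMap γ n φ' - hatMap γ n (φ + φ') := by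
  rw [cross, dHat_sumTerm (γ.dHat_susp n) (isChainMap_of_sym h) (isChainMap_of_sym h'), hatMap_add]
  abel

/-- The sum of `(φ, θ)` and `(φ', θ')` is `(φ + φ', θ + θ' + ζ)` with
`ζ_s = ± φ_0 (S^n γ)_{s+1} φ'_0^*`. -/
instance : AddGroup (TwStr γ n) :=
  letI add : Add (TwStr γ n) := ⟨fun s t =>
    { φ := s.φ + t.φ
      θ := s.θ + t.θ + cross γ n s.φ t.φ
      φ_mem := add_mem s.φ_mem t.φ_mem
      dθ := by
        rw [map_add, map_add, s.dθ, t.dθ, dHat_cross s.φ_mem t.φ_mem]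
        abel }⟩
  letI zero : Zero (TwStr γ n) := ⟨
    { φ := 0
      θ := 0
      φ_mem := zero_mem _
      dθ := by rw [map_zero, hatMap_zero, sub_zero] }⟩
  letI neg : Neg (TwStr γ n) := ⟨fun s =>
    { φ := - s.φ
      θ := - s.θ + cross γ n s.φ s.φ
      φ_mem := neg_mem s.φ_mem
      dθ := by
        have h2 := dHat_cross (γ := γ) (neg_mem s.φ_mem) s.φ_mem
        rw [cross_neg_left, map_neg, neg_add_cancel, hatMap_zero, hatMap_neg] at h2
        rw [map_add, map_neg, s.dθ, neg_eq_iff_eq_neg.1 h2, hatMap_neg]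
        abel }⟩
  AddGroup.ofLeftAxioms
    (by
      intro a b c
      apply TwStr.ext
      · exact add_assoc _ _ _
      · change a.θ + b.θ + cross γ n a.φ b.φ + c.θ + cross γ n (a.φ + b.φ) c.φ =
          a.θ + (b.θ + c.θ + cross γ n b.φ c.φ) + cross γ n a.φ (b.φ + c.φ)
        rw [cross_add_left, cross_add_right]
        abel)
    (by
      intro a
      apply TwStr.ext
      · exact zero_add _
      · change 0 + a.θ + cross γ n 0 a.φ = a.θ
        rw [cross_zero_left, zero_add, add_zero])
    (by
      intro a
      apply TwStr.ext
      · exact neg_add_cancel _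
      · change - a.θ + cross γ n a.φ a.φ + a.θ + cross γ n (-a.φ) a.φ = 0
        rw [cross_neg_left]
        abel)

theorem add_φ (s t : TwStr γ n) : (s + t).φ = s.φ + t.φ := rfl

theorem add_θ (s t : TwStr γ n) : (s + t).θ = s.θ + t.θ + cross γ n s.φ t.φ := rfl

/-- The term `(ξ_0; φ_0, φ'_0)^%(S^n γ)` for a homotopy `ξ` from `φ` to `φ'`. -/
abbrev homTerm (γ : ChainBundle C) (n : ℤ) (ξ φ φ' : Fam C C) : Fam C C :=
  homotopyTerm n (susp C n γ.g) (homot n ξ) (chain n φ) (chain n φ')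

/-- Equivalence of structures `(φ, θ)` and `(φ', θ')`: there are a symmetric `ξ` of degree `n + 1` and a
hyperquadratic `η` of degree `n + 2` with `φ' - φ = dξ` and
`θ' - θ = J ξ - (ξ_0; φ_0, φ'_0)^%(S^n γ) + dη`. -/
def Equivalent (s t : TwStr γ n) : Prop :=
  ∃ ξ η : Fam C C, ξ ∈ symChains C (n + 1) ∧ dHat C (n + 1) ξ = t.φ - s.φ ∧
    dHat C (n + 2) η = t.θ - s.θ - ξ + homTerm γ n ξ s.φ t.φ

theorem homTerm_zero (φ φ' : Fam C C) : homTerm γ n 0 φ φ' = 0 := by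
  have h : homot n (0 : Fam C C) = 0 := rfl
  funext p q
  simp only [homTerm, homotopyTerm, h, Pi.add_apply, Pi.smul_apply, hL_apply, hR_apply, hM_apply,
    Pi.zero_apply, Matrix.zero_mul, Matrix.transpose_zero, Matrix.mul_zero, smul_zero, add_zero]

theorem homTerm_trans {φ φ' φ'' ξ ξ' : Fam C C} (hξ : ξ ∈ symChains C (n + 1))
    (hξ' : ξ' ∈ symChains C (n + 1)) (h : dHat C (n + 1) ξ = φ' - φ)
    (h' : dHat C (n + 1) ξ' = φ'' - φ') :
    ∃ η, dHat C (n + 2) η = homTerm γ n (ξ + ξ') φ φ'' - homTerm γ n ξ φ φ' -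
      homTerm γ n ξ' φ' φ'' := by
  have e := homotopyTerm_trans (F := chain n φ) (γ.dHat_susp n) (isHomotopy_of_sym hξ h)
    (isHomotopy_of_sym hξ' h')
  have e1 : chain n φ + chain n (φ' - φ) = chain n φ' := by
    change chain n (φ + (φ' - φ)) = _
    rw [add_sub_cancel]
  have e2 : chain n φ' + chain n (φ'' - φ') = chain n φ'' := by
    change chain n (φ' + (φ'' - φ')) = _
    rw [add_sub_cancel]
  rw [e1, e2] at e
  refine ⟨hM (homot n ξ') (homot n ξ) (susp C n γ.g), ?_⟩
  rw [homTerm, show homot n (ξ + ξ') = homot n ξ + homot n ξ' from rfl, e]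
  abel

theorem homTerm_add {φ φ' ψ ψ' ξ ξ' : Fam C C} (hξ : ξ ∈ symChains C (n + 1))
    (hξ' : ξ' ∈ symChains C (n + 1)) (hφ : φ' ∈ symCycles C n) (hψ : ψ ∈ symCycles C n)
    (h : dHat C (n + 1) ξ = φ' - φ) (h' : dHat C (n + 1) ξ' = ψ' - ψ) :
    ∃ η, dHat C (n + 2) η = homTerm γ n (ξ + ξ') (φ + ψ) (φ' + ψ') + cross γ n φ' ψ' -
      cross γ n φ ψ - homTerm γ n ξ φ φ' - homTerm γ n ξ' ψ ψ' := by
  have e1 : chain n φ + chain n (φ' - φ) = chain n φ' := by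
    change chain n (φ + (φ' - φ)) = _
    rw [add_sub_cancel]
  have e2 : chain n ψ + chain n (ψ' - ψ) = chain n ψ' := by
    change chain n (ψ + (ψ' - ψ)) = _
    rw [add_sub_cancel]
  have e := homotopyTerm_add (F := chain n φ) (G := chain n ψ) (γ.dHat_susp n)
    (by rw [e1]; exact isChainMap_of_sym hφ) (isChainMap_of_sym hψ) (isHomotopy_of_sym hξ h)
    (isHomotopy_of_sym hξ' h')
  rw [e1, e2] at e
  refine ⟨hM (homot n ξ') (homot n ξ) (susp C n γ.g) - n.negOnePow •
    (hL (homot n ξ) (chain n ψ) (transp _ _ (susp C n γ.g)) +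
      hR (chain n φ') (homot n ξ') (transp _ _ (susp C n γ.g))), ?_⟩
  rw [homTerm, show homot n (ξ + ξ') = homot n ξ + homot n ξ' from rfl,
      show chain n (φ + ψ) = chain n φ + chain n ψ from rfl,
      show chain n (φ' + ψ') = chain n φ' + chain n ψ' from rfl, cross, cross, e]
  abel

def con (γ : ChainBundle C) (n : ℤ) : AddCon (TwStr γ n) where
  r := Equivalent
  iseqv :=
    { refl := fun s => ⟨0, 0, zero_mem _, by simp, by simp [homTerm_zero]⟩
      symm := by
        rintro s t ⟨ξ, η, hξ, h1, h2⟩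
        have h3 : dHat C (n + 1) (-ξ) = s.φ - t.φ := by rw [map_neg, h1, neg_sub]
        obtain ⟨ζ, hζ⟩ := homTerm_trans (γ := γ) hξ (neg_mem hξ) h1 h3
        rw [add_neg_cancel, homTerm_zero] at hζ
        refine ⟨-ξ, - η - ζ, neg_mem hξ, h3, ?_⟩
        rw [map_sub, map_neg, h2, hζ]
        abel
      trans := by
        rintro s t u ⟨ξ, η, hξ, h1, h2⟩ ⟨ξ', η', hξ', h1', h2'⟩
        obtain ⟨ζ, hζ⟩ := homTerm_trans (γ := γ) hξ hξ' h1 h1'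
        refine ⟨ξ + ξ', η + η' + ζ, add_mem hξ hξ', by rw [map_add, h1, h1']; abel, ?_⟩
        rw [map_add, map_add, h2, h2', hζ]
        abel }
  add' := by
    rintro s t s' t' ⟨ξ, η, hξ, h1, h2⟩ ⟨ξ', η', hξ', h1', h2'⟩
    obtain ⟨ζ, hζ⟩ := homTerm_add (γ := γ) hξ hξ' t.φ_mem s'.φ_mem h1 h1'
    refine ⟨ξ + ξ', η + η' + ζ, add_mem hξ hξ', ?_, ?_⟩
    · rw [map_add, h1, h1', add_φ, add_φ]
      abel
    · rw [map_add, map_add, h2, h2', hζ, add_φ, add_φ, add_θ, add_θ]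
      abel

theorem con_comm (s t : TwStr γ n) : con γ n (s + t) (t + s) := by
  refine ⟨0, conj (chain n s.φ) (chain n t.φ) (susp C n γ.g), zero_mem _, ?_, ?_⟩
  · rw [map_zero, add_φ, add_φ, add_comm, sub_self]
  · have h := sumTerm_comm (γ.dHat_susp n) (isChainMap_of_sym s.φ_mem) (isChainMap_of_sym t.φ_mem)
    rw [map_neg, neg_eq_iff_eq_neg, neg_sub] at h
    rw [h, homTerm_zero, add_θ, add_θ, cross, cross]
    abel

end TwStr

/-- The twisted quadratic group `Q_n(C, γ)` of equivalence classes of structures. -/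
def TwistedQ (γ : ChainBundle C) (n : ℤ) : Type u := (TwStr.con γ n).Quotient

instance (γ : ChainBundle C) (n : ℤ) : AddCommGroup (TwistedQ γ n) :=
  { (inferInstance : AddGroup (TwStr.con γ n).Quotient) with
    add_comm := by
      intro a b
      induction a, b using AddCon.induction_on₂ with
      | H s t => exact (AddCon.eq _).2 (TwStr.con_comm s t) }

/-- The class of a structure in `Q_n(C, γ)`. -/
def TwistedQ.mk {γ : ChainBundle C} {n : ℤ} (s : TwStr γ n) : TwistedQ γ n :=
  (TwStr.con γ n).mk' s

/-- The map `N_γ : Q_n(C, γ) → Q^n(C)`, `(φ, θ) ↦ φ`. -/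
def symPart (γ : ChainBundle C) (n : ℤ) : TwistedQ γ n →+ SymQ C n :=
  (TwStr.con γ n).lift
    (AddMonoidHom.mk' (fun s => ((⟨s.φ, s.φ_mem⟩ : symCycles C n) : SymQ C n))
      (fun _ _ => rfl))
    (by
      rintro s t ⟨ξ, η, hξ, h1, h2⟩
      refine (QuotientAddGroup.eq).2 ⟨ξ, hξ, ?_⟩
      rw [h1, sub_eq_neg_add]
      rfl)

/-- The map `H_γ : Q̂^{n+1}(C) → Q_n(C, γ)`, `θ ↦ (0, θ)`. -/
def hatPart (γ : ChainBundle C) {m n : ℤ} (h : m = n + 1) : HatQ C m →+ TwistedQ γ n :=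
  QuotientAddGroup.lift _
    (AddMonoidHom.mk' (fun θ : (dHat C m).ker => TwistedQ.mk
        { φ := 0
          θ := θ.1
          φ_mem := zero_mem _
          dθ := by
            subst h
            rw [TwStr.hatMap_zero, sub_zero]
            exact θ.2 })
      (by
        intro θ θ'
        refine congrArg (TwistedQ.mk (γ := γ) (n := n)) (TwStr.ext (add_zero _).symm ?_)
        change _ = θ.1 + θ'.1 + TwStr.cross γ n 0 0
        rw [TwStr.cross_zero_left, add_zero]
        rfl))
    (by
      rintro ⟨θ, hθ⟩ ⟨η, hη⟩
      refine ((AddCon.eq _).2 (⟨0, η, zero_mem _, ?_, ?_⟩ : TwStr.Equivalent _ _)).symm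
      · rw [map_zero]
        exact (sub_self _).symm
      · rw [TwStr.homTerm_zero, show n + 2 = m + 1 by rw [h]; ring, hη]
        change θ = θ - 0 - 0 + 0
        simp)

/-- The component `H_{n+1}(D ⊗ C) → Q̂^{n+1}(C) → Q_n(C, γ)`,
`(f : D^{n+1-*} → C) ↦ (0, f^%(S^{n+1} δ))`, of the connecting map for the sum of the chain bundles
`(D, δ)` and `(C, γ)`. -/
def connecting {D : BasedComplex R} (δ : ChainBundle D) (γ : ChainBundle C) {m n : ℤ}
    (h : m = n + 1) : TensorH D C m →+ TwistedQ γ n :=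
  (hatPart γ h).comp (hatPush δ C m)

end Twisted

end BasedComplex

namespace BasedComplex

/-- The complex `C(X)` of free modules of rank `r` in degrees `1` and `0` and zero elsewhere, with
differential multiplication by `2` from degree `1` to degree `0`. -/
def cone (R : Type u) [CommRing R] (r : ℕ) : BasedComplex R where
  ι k := {_i : Fin r // k = 0 ∨ k = 1}
  fin _ := inferInstance
  bounded := by
    refine ⟨1, fun k hk => ⟨fun i => ?_⟩⟩
    rcases i.2 with h | h <;> simp [h] at hk
  d q k := Matrix.of fun i j => if q = 0 ∧ k = 1 ∧ i.1 = j.1 then 2 else 0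
  shape q k h := by
    ext i j
    simp only [Matrix.of_apply, Matrix.zero_apply, ite_eq_right_iff]
    omega
  d_comp_d p q k := by
    ext i j
    rw [Matrix.mul_apply]
    refine Finset.sum_eq_zero fun l _ => ?_
    simp only [Matrix.of_apply]
    by_cases h : q = 0
    · rw [if_neg (by omega), zero_mul]
    · rw [if_neg (c := q = 0 ∧ _) (by tauto), mul_zero]

/-- The components `C(X)_a → C(X)^b` of `γ(X)`: `X` for `(a, b) = (0, 0)`, and `2X` for
`(a, b) = (0, 1), (1, 1)`. -/
def coneFam {R : Type u} [CommRing R] {r : ℕ} (X : Matrix (Fin r) (Fin r) R) (a b : ℤ) :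
    Matrix ((cone R r).ι b) ((cone R r).ι a) R :=
  Matrix.of fun i j =>
    if a = 0 ∧ b = 0 then X i.1 j.1 else if b = 1 then 2 * X i.1 j.1 else 0

theorem cone_d_apply {R : Type u} [CommRing R] {r : ℕ} (q k : ℤ) (i : (cone R r).ι q)
    (j : (cone R r).ι k) :
    (cone R r).d q k i j = if q = 0 ∧ k = 1 ∧ i.1 = j.1 then 2 else 0 := rfl

theorem coneFam_apply {R : Type u} [CommRing R] {r : ℕ} (X : Matrix (Fin r) (Fin r) R) (a b : ℤ)
    (i : (cone R r).ι b) (j : (cone R r).ι a) : coneFam X a b i j =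
      if a = 0 ∧ b = 0 then X i.1 j.1 else if b = 1 then 2 * X i.1 j.1 else 0 := rfl

/-- The `i`-th basis element of `C(X)_0`. -/
def bot (R : Type u) [CommRing R] {r : ℕ} (i : Fin r) : (cone R r).ι 0 := ⟨i, Or.inl rfl⟩

/-- The `i`-th basis element of `C(X)_1`. -/
def top (R : Type u) [CommRing R] {r : ℕ} (i : Fin r) : (cone R r).ι 1 := ⟨i, Or.inr rfl⟩

theorem coneFam_key {R : Type u} [CommRing R] {r : ℕ} {X : Matrix (Fin r) (Fin r) R}
    (hX : X.IsSymm) (a b a' b' : ℤ) (ha : a' = a - 1) (hb : b' = b - 1) :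
    (b + 1).negOnePow • (((cone R r).d b' b).transpose * coneFam X a b') +
      (a + b + 1).negOnePow • (coneFam X a' b * (cone R r).d a' a) +
      (a + b).negOnePow • coneFam X a b +
      (a * b + 1).negOnePow • (coneFam X b a).transpose = 0 := by
  have e1 : ∀ (M : Matrix ((cone R r).ι 0) ((cone R r).ι a) R) i j,
      (((cone R r).d 0 1).transpose * M) i j = 2 * M (bot R i.1) j := by
    intro M i j
    refine (Finset.sum_eq_single (bot R i.1) ?_ (fun h => absurd (Finset.mem_univ _) h)).trans ?_
    · intro l _ hl
      have h : (cone R r).d 0 1 l i = 0 := by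
        rw [cone_d_apply, if_neg (fun h => hl (Subtype.ext h.2.2))]
      exact (congrArg (· * M l j) h).trans (zero_mul _)
    · have h : (cone R r).d 0 1 (bot R i.1) i = 2 := by
        rw [cone_d_apply, if_pos ⟨rfl, rfl, rfl⟩]
      exact congrArg (· * M (bot R i.1) j) h
  have e2 : ∀ (M : Matrix ((cone R r).ι b) ((cone R r).ι 0) R) i j,
      (M * (cone R r).d 0 1) i j = M i (bot R j.1) * 2 := by
    intro M i j
    refine (Finset.sum_eq_single (bot R j.1) ?_ (fun h => absurd (Finset.mem_univ _) h)).trans ?_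
    · intro l _ hl
      have h : (cone R r).d 0 1 l j = 0 := by
        rw [cone_d_apply, if_neg (fun h => hl (Subtype.ext h.2.2))]
      exact (congrArg (M i l * ·) h).trans (mul_zero _)
    · have h : (cone R r).d 0 1 (bot R j.1) j = 2 := by
        rw [cone_d_apply, if_pos ⟨rfl, rfl, rfl⟩]
      exact congrArg (M i (bot R j.1) * ·) h
  have e3 : ∀ b b', b ≠ 1 → (cone R r).d b' b = 0 := by
    intro b b' h
    ext i j
    rw [cone_d_apply, if_neg (fun h' => h h'.2.1)]
    rfl
  have hb1 : ∀ i : Fin r, (bot R i).1 = i := fun _ => rfl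
  have n2 : Int.negOnePow 2 = 1 := rfl
  have n3 : Int.negOnePow 3 = -1 := rfl
  ext i j
  have hs : X j.1 i.1 = X i.1 j.1 := hX.apply i.1 j.1
  rcases i.2 with hi | hi <;> rcases j.2 with hj | hj <;> subst hi <;> subst hj <;>
    simp only [zero_sub, sub_self] at ha hb <;> subst ha <;> subst hb
  · rw [e3 0 _ (by norm_num)]
    simp [coneFam_apply, hb1, hs]
  · rw [e3 0 _ (by norm_num)]
    simp only [Matrix.add_apply, Matrix.smul_apply, e2]
    simp [coneFam_apply, hb1, hs, n2, mul_comm]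
  · rw [e3 0 _ (by norm_num)]
    simp only [Matrix.add_apply, Matrix.smul_apply, e1]
    simp [coneFam_apply, hb1, hs, n2]
  · simp only [Matrix.add_apply, Matrix.smul_apply, e1, e2]
    simp [coneFam_apply, hb1, hs, n2, n3]
    ring

/-- The chain bundle `γ(X)` over `C(X)`: the cone of the chain bundle map `(2, 2X)` from
`(R^r, 0)` to `(R^r, X)`, for a symmetric matrix `X`. -/
def coneBundle {R : Type u} [CommRing R] {r : ℕ} (X : Matrix (Fin r) (Fin r) R) (hX : X.IsSymm) :
    ChainBundle (cone R r) where
  g := coneFam X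
  cocycle := by
    funext p q
    rw [dHat_susp_apply, coneFam_key hX _ _ _ _ (by ring) (by ring), smul_zero]
    rfl

end BasedComplex

/-- `A` is 1-even: `2` is not a zero divisor and `a - a²` is divisible by `2` for every `a`. -/
def IsOneEven (A : Type u) [CommRing A] : Prop :=
  (2 : A) ∈ nonZeroDivisors A ∧ ∀ a : A, 2 ∣ a - a ^ 2

/-- `A_k = A/kA`. -/
abbrev ModBy (A : Type u) [CommRing A] (k : ℕ) : Type u := A ⧸ Ideal.span {(k : A)}

/-- The class of `a` in `A_k`. -/
abbrev cls {A : Type u} [CommRing A] (k : ℕ) (a : A) : ModBy A k := Ideal.Quotient.mk _ a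

/-- Coefficientwise reduction `A[x] → A_k[x]`. -/
noncomputable abbrev red {A : Type u} [CommRing A] (k : ℕ) (a : Polynomial A) :
    Polynomial (ModBy A k) :=
  a.map (Ideal.Quotient.mk _)

/-- The sum `∑ⱼ c ((2i+1)2ʲ)` over all `j ≥ 0`, for a finitely supported sequence `c`. -/
noncomputable def dyadicSum {M : Type u} [AddCommMonoid M] (c : ℕ → M) (i : ℕ) : M :=
  ∑ᶠ j : ℕ, c ((2 * i + 1) * 2 ^ j)

namespace Explicit

variable {R : Type u} [CommRing R]

/-- The subgroup `2R + {b - b²u}` of `R`. -/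
def denNeg (u : R) : AddSubgroup R where
  carrier := {a | ∃ b c : R, a = 2 * c + (b - b ^ 2 * u)}
  zero_mem' := ⟨0, 0, by ring⟩
  add_mem' := by
    rintro _ _ ⟨b, c, rfl⟩ ⟨b', c', rfl⟩
    exact ⟨b + b', c + c' + b * b' * u, by ring⟩
  neg_mem' := by
    rintro _ ⟨b, c, rfl⟩
    exact ⟨-b, -c + b ^ 2 * u, by ring⟩

/-- The subgroup `{a | a - a²u ∈ 2R}` of `R`. -/
def num (u : R) : AddSubgroup R where
  carrier := {a | ∃ c : R, a - a ^ 2 * u = 2 * c}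
  zero_mem' := ⟨0, by ring⟩
  add_mem' := by
    rintro a b ⟨c, hc⟩ ⟨d, hd⟩
    exact ⟨c + d - a * b * u, by linear_combination hc + hd⟩
  neg_mem' := by
    rintro a ⟨c, hc⟩
    exact ⟨-c - a ^ 2 * u, by linear_combination - hc⟩

/-- The subgroup `8R + {4b - 4b²u}` of `R`. -/
def denZero (u : R) : AddSubgroup R where
  carrier := {a | ∃ b c : R, a = 8 * c + (4 * b - 4 * b ^ 2 * u)}
  zero_mem' := ⟨0, 0, by ring⟩
  add_mem' := by
    rintro _ _ ⟨b, c, rfl⟩ ⟨b', c', rfl⟩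
    exact ⟨b + b', c + c' + b * b' * u, by ring⟩
  neg_mem' := by
    rintro _ ⟨b, c, rfl⟩
    exact ⟨-b, -c + b ^ 2 * u, by ring⟩

/-- The subgroup `2R` of `R`. -/
def denOne (R : Type u) [CommRing R] : AddSubgroup R := (AddMonoidHom.mulLeft (2 : R)).range

/-- `R / (2R + {b - b²u})`. -/
abbrev QNeg (u : R) : Type u := R ⧸ denNeg u

/-- `{a | a - a²u ∈ 2R} / (8R + {4b - 4b²u})`. -/
abbrev QZero (u : R) : Type u := num u ⧸ (denZero u).addSubgroupOf (num u)

/-- `{a | a - a²u ∈ 2R} / 2R`. -/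
abbrev QOne (u : R) : Type u := num u ⧸ (denOne R).addSubgroupOf (num u)

end Explicit

namespace BasedComplex

/-- The complex `2 : R → R` concentrated in degrees `1` and `0`, underlying `C(u)` for
every `u ∈ R`. -/
abbrev C₁ (R : Type u) [CommRing R] : BasedComplex R := cone R 1

/-- The chain bundle `γ(u)` over `C(u)` for `u ∈ R`. -/
def γ₁ {R : Type u} [CommRing R] (u : R) : ChainBundle (C₁ R) :=
  coneBundle !![u] (by ext i j; simp [Subsingleton.elim i j])

/-- The component `C^0 → C_0` of a family. -/
def c00 {R : Type u} [CommRing R] (f : Fam (C₁ R) (C₁ R)) : R := f 0 0 (bot R 0) (bot R 0)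

/-- The component `C^0 → C_1` of a family. -/
def c01 {R : Type u} [CommRing R] (f : Fam (C₁ R) (C₁ R)) : R := f 0 1 (top R 0) (bot R 0)

end BasedComplex

open Polynomial

/-! The argument has a topological half, over any commutative ring `R` in which 2 is not a zero
divisor, and an arithmetic half in `A[x]`.

The complex `2 : R → R` has rank one in degrees 0 and 1, so a family is four scalars and all
structure equations become polynomial identities. In degree -1 everything except `θ₀₀` can be
removed, and `θ₀₀` moves by `2R + {b - b²u}`. In degree 0 the entry `φ₀₀` is not invariant, but
`zeroInv` corrects it to an invariant modulo `8R + {4b - 4b²u}`, which is additive and complete. In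
degree 1 a symmetric cycle is determined by its entry `b : C^0 → C_1`; it lifts to a twisted
structure exactly when `b - b²u` is even, and it bounds exactly when `b` is even. The connecting
maps send `c` to the classes of `-4vc²` and `vc²`, where `v` is the parameter of the source bundle.

For the arithmetic, 1-evenness gives `b² ≡ expand A 2 b` mod 2, so mod 2 the map `b ↦ b²x` is the
additive shift `x^k ↦ x^(2k+1)`. Its orbits are the sets of `k` for which `k + 1` has a given odd
part `2i + 1`, and `foldOdd` collapses each orbit to `x^i`. It is split by `expand A 2`, and its
kernel is `{b - X * expand A 2 b}`. This computes the first quotient for `u = x`. Elements of the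
numerator of the second are even, `a = 2b`, and `2b` lies in the denominator iff `foldOdd b ≡ 0` mod
4 and `oddPart b ≡ 0` mod 2 (`two_mul_mem_denZero_X_iff`). The case `u = 1` splits as constants plus
`X` times the case `u = x` (`sub_sq_C_add`). Finally `foldOdd (c²) ≡ c` mod 2 makes the squares in
the connecting maps disappear. -/

/-! ### Folding polynomials along the orbits of `k ↦ 2k + 1`. -/

namespace DyadicPoly

variable {A : Type u} [CommRing A]

/-- The index `i` with `k + 1 = (2 i + 1) 2 ^ j` for some `j`. -/
def oddIndex (k : ℕ) : ℕ := if Even k then k / 2 else oddIndex (k / 2)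
termination_by k
decreasing_by
  rename_i h
  have : k ≠ 0 := by rintro rfl; simp at h
  omega

theorem oddIndex_two_mul (k : ℕ) : oddIndex (2 * k) = k := by
  rw [oddIndex, if_pos (by simp)]; omega

theorem oddIndex_two_mul_add_one (k : ℕ) : oddIndex (2 * k + 1) = oddIndex k := by
  rw [oddIndex, if_neg (by simp)]
  congr 1
  omega

/-- Because `(2l + 1) + 1 = 2(l + 1)`, passing from `l` to `2l + 1` raises `j` by one and keeps `i`;
even `k` are the case `j = 0`. -/
theorem oddIndex_eq {i : ℕ} (j : ℕ) : ∀ {k : ℕ}, k + 1 = (2 * i + 1) * 2 ^ j → oddIndex k = i := by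
  induction j with
  | zero =>
    intro k h
    obtain rfl : k = 2 * i := by simpa using h
    exact oddIndex_two_mul i
  | succ j ih =>
    intro k h
    obtain ⟨l, rfl⟩ : ∃ l, k = 2 * l + 1 := ⟨(2 * i + 1) * 2 ^ j - 1, by
      have : 0 < (2 * i + 1) * 2 ^ j := by positivity
      rw [pow_succ, ← mul_assoc] at h
      omega⟩
    rw [oddIndex_two_mul_add_one]
    refine ih ?_
    rw [pow_succ, ← mul_assoc] at h
    omega

theorem exists_oddIndex (k : ℕ) : ∃ j, k + 1 = (2 * oddIndex k + 1) * 2 ^ j := by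
  induction k using Nat.strong_induction_on with
  | _ k ih =>
    obtain ⟨l, rfl | rfl⟩ := Nat.even_or_odd' k
    · exact ⟨0, by rw [oddIndex_two_mul]; simp⟩
    · obtain ⟨j, hj⟩ := ih l (by omega)
      refine ⟨j + 1, ?_⟩
      rw [oddIndex_two_mul_add_one, pow_succ, ← mul_assoc, ← hj]
      ring

/-- The additive map with `c x ^ k ↦ c x ^ oddIndex k`. -/
noncomputable def foldOdd : A[X] →ₗ[A] A[X] :=
  Polynomial.lsum fun k => monomial (oddIndex k)

theorem foldOdd_monomial (k : ℕ) (c : A) :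
    foldOdd (monomial k c) = monomial (oddIndex k) c := by
  simp [foldOdd, Polynomial.lsum_apply]

theorem dyadicSum_add (a b : A[X]) (i : ℕ) :
    dyadicSum (fun k => (a + b).coeff (k - 1)) i =
      dyadicSum (fun k => a.coeff (k - 1)) i + dyadicSum (fun k => b.coeff (k - 1)) i := by
  -- `finsum` is additive only for finite supports; here `j < 2 ^ j` bounds `j` by the degree.
  have hfin : ∀ p : A[X],
      (Function.support fun j : ℕ => p.coeff ((2 * i + 1) * 2 ^ j - 1)).Finite := by
    intro p
    refine (Set.finite_Iic p.natDegree).subset fun j hj => ?_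
    have h1 := le_natDegree_of_ne_zero hj
    have h2 : j < 2 ^ j := Nat.lt_two_pow_self
    have h3 : 2 ^ j ≤ (2 * i + 1) * 2 ^ j := Nat.le_mul_of_pos_left _ (by omega)
    exact Set.mem_Iic.2 (by omega)
  simp only [dyadicSum, coeff_add]
  exact finsum_add_distrib (hfin a) (hfin b)

theorem dyadicSum_monomial (k : ℕ) (c : A) (i : ℕ) :
    dyadicSum (fun l => (monomial k c).coeff (l - 1)) i = if oddIndex k = i then c else 0 := by
  simp only [dyadicSum, coeff_monomial]
  split_ifs with h
  · obtain ⟨j, hj⟩ := exists_oddIndex k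
    rw [h] at hj
    rw [finsum_eq_single _ j, if_pos (by omega)]
    intro l hl
    refine if_neg fun h' => hl ?_
    -- Positivity makes the truncated subtraction of 1 reversible.
    have h0 : 0 < (2 * i + 1) * 2 ^ l := by positivity
    have h1 : (2 * i + 1) * 2 ^ l = (2 * i + 1) * 2 ^ j := by omega
    exact Nat.pow_right_injective le_rfl (Nat.eq_of_mul_eq_mul_left (by omega) h1)
  · refine (finsum_congr fun j => if_neg fun h' => h ?_).trans finsum_zero
    have h0 : 0 < (2 * i + 1) * 2 ^ j := by positivity
    exact oddIndex_eq j (by omega)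

theorem coeff_foldOdd (a : A[X]) (i : ℕ) :
    (foldOdd a).coeff i = dyadicSum (fun k => a.coeff (k - 1)) i := by
  induction a using Polynomial.induction_on' with
  | add p q hp hq => rw [map_add, coeff_add, hp, hq, dyadicSum_add]
  | monomial k c => rw [foldOdd_monomial, coeff_monomial, dyadicSum_monomial]

/-- Each orbit of `k ↦ 2k + 1` starts at one even exponent `2i`, so `expand A 2` chooses the
starting points and splits `foldOdd`. -/
theorem foldOdd_expand (a : A[X]) : foldOdd (expand A 2 a) = a := by
  induction a using Polynomial.induction_on' with
  | add p q hp hq => rw [map_add, map_add, hp, hq]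
  | monomial k c => rw [expand_monomial, foldOdd_monomial, mul_comm k, oddIndex_two_mul]

theorem foldOdd_X_mul_expand (a : A[X]) : foldOdd (X * expand A 2 a) = foldOdd a := by
  induction a using Polynomial.induction_on' with
  | add p q hp hq => rw [map_add, mul_add, map_add, map_add, hp, hq]
  | monomial k c =>
    rw [expand_monomial, X_mul_monomial, foldOdd_monomial, mul_comm k, oddIndex_two_mul_add_one,
      foldOdd_monomial]

/-- A monomial is moved down its orbit by `x^(2l+1) = x^l - (x^l - x^(2l+1))` until it reaches the
even starting exponent. Hence the kernel of `foldOdd` is no larger than `{b - X * expand A 2 b}`. -/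
theorem exists_sub_expand_foldOdd (a : A[X]) :
    ∃ b : A[X], a = expand A 2 (foldOdd a) + (b - X * expand A 2 b) := by
  induction a using Polynomial.induction_on' with
  | add p q hp hq =>
    obtain ⟨b, hb⟩ := hp
    obtain ⟨c, hc⟩ := hq
    refine ⟨b + c, ?_⟩
    conv_lhs => rw [hb, hc]
    simp only [map_add]
    ring
  | monomial k c =>
    induction k using Nat.strong_induction_on with
    | _ k ih =>
      rw [foldOdd_monomial, expand_monomial]
      obtain ⟨l, rfl | rfl⟩ := Nat.even_or_odd' k
      · exact ⟨0, by rw [oddIndex_two_mul, mul_comm]; simp⟩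
      · obtain ⟨b, hb⟩ := ih l (by omega)
        rw [foldOdd_monomial, expand_monomial] at hb
        refine ⟨b - monomial l c, ?_⟩
        have h : X * expand A 2 (monomial l c) = monomial (2 * l + 1) c := by
          rw [expand_monomial, X_mul_monomial, mul_comm]
        rw [oddIndex_two_mul_add_one, map_sub, mul_sub, h]
        linear_combination hb

/-- The polynomial `∑ a_{2k+1} x ^ k` formed by the coefficients in odd degrees. -/
noncomputable def oddPart (a : A[X]) : A[X] := contract 2 (divX a)

theorem coeff_oddPart (a : A[X]) (k : ℕ) : (oddPart a).coeff k = a.coeff (2 * k + 1) := by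
  rw [oddPart, coeff_contract two_ne_zero, coeff_divX, mul_comm]

theorem oddPart_add (a b : A[X]) : oddPart (a + b) = oddPart a + oddPart b := by
  ext k; simp [coeff_oddPart]

theorem oddPart_sub (a b : A[X]) : oddPart (a - b) = oddPart a - oddPart b := by
  ext k; simp [coeff_oddPart]

theorem oddPart_two_mul (a : A[X]) : oddPart (2 * a) = 2 * oddPart a := by
  rw [two_mul, two_mul, oddPart_add]

theorem oddPart_expand (a : A[X]) : oddPart (expand A 2 a) = 0 := by
  ext k
  rw [coeff_oddPart, coeff_expand two_pos, if_neg (by omega), coeff_zero]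

theorem oddPart_X_mul_expand (a : A[X]) : oddPart (X * expand A 2 a) = a := by
  ext k
  rw [coeff_oddPart, coeff_X_mul, coeff_expand_mul' two_pos]

theorem foldOdd_two_mul (a : A[X]) : foldOdd (2 * a) = 2 * foldOdd a := by
  rw [two_mul, two_mul, map_add]

theorem two_dvd_of_two_dvd_coeff {a : A[X]} (h : ∀ k, (2 : A) ∣ a.coeff k) : (2 : A[X]) ∣ a := by
  rw [← map_ofNat C 2]
  exact (C_dvd_iff_dvd_coeff (2 : A) a).2 h

theorem two_dvd_coeff {a : A[X]} (h : (2 : A[X]) ∣ a) (k : ℕ) : (2 : A) ∣ a.coeff k :=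
  (C_dvd_iff_dvd_coeff (2 : A) a).1 (by rwa [map_ofNat C 2]) k

/-- A polynomial whose coefficients satisfy `a_k ≡ a_{2k+1} mod 2` is divisible by `2`. -/
theorem two_dvd_of_sub_oddPart {a : A[X]} (h : (2 : A[X]) ∣ a - oddPart a) : (2 : A[X]) ∣ a := by
  refine two_dvd_of_two_dvd_coeff fun k => ?_
  -- Descending induction on `k`: coefficients above the degree vanish, and `2k + 1 > k`.
  induction h' : a.natDegree + 1 - k using Nat.strong_induction_on generalizing k with
  | _ n ih =>
    by_cases hk : a.natDegree < k
    · rw [coeff_eq_zero_of_natDegree_lt hk]; exact dvd_zero _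
    · have h1 := ih (a.natDegree + 1 - (2 * k + 1)) (by omega) (2 * k + 1) rfl
      have h2 := two_dvd_coeff h k
      rw [coeff_sub, coeff_oddPart] at h2
      exact (dvd_sub_left h1).1 h2

/-- Here the induction ascends: `X * expand A 2 a` has no even-degree terms, so `a_{2l}` is even,
and `a_{2l+1} ≡ a_l` with `l < 2l + 1`. -/
theorem two_dvd_of_sub_X_mul_expand {a : A[X]} (h : (2 : A[X]) ∣ a - X * expand A 2 a) :
    (2 : A[X]) ∣ a := by
  refine two_dvd_of_two_dvd_coeff fun k => ?_
  induction k using Nat.strong_induction_on with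
  | _ k ih =>
    have h2 := two_dvd_coeff h k
    rw [coeff_sub] at h2
    obtain ⟨l, rfl | rfl⟩ := Nat.even_or_odd' k
    · have h0 : (X * expand A 2 a).coeff (2 * l) = 0 := by
        cases l with
        | zero => simp
        | succ l =>
          rw [show 2 * (l + 1) = 2 * l + 1 + 1 by ring, coeff_X_mul, coeff_expand two_pos,
            if_neg (by omega)]
      rwa [h0, sub_zero] at h2
    · rw [coeff_X_mul, coeff_expand_mul' two_pos] at h2
      exact (dvd_sub_left (ih l (by omega))).1 h2

/-- Squaring is additive mod 2, and on a monomial `c² ≡ c` by 1-evenness. -/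
theorem two_dvd_sq_sub_expand (hA : IsOneEven A) (a : A[X]) :
    (2 : A[X]) ∣ a ^ 2 - expand A 2 a := by
  induction a using Polynomial.induction_on' with
  | add p q hp hq =>
    have h : (p + q) ^ 2 - expand A 2 (p + q) =
        (p ^ 2 - expand A 2 p) + (q ^ 2 - expand A 2 q) + 2 * (p * q) := by
      rw [map_add]; ring
    rw [h]
    exact dvd_add (dvd_add hp hq) (dvd_mul_right _ _)
  | monomial k c =>
    obtain ⟨d, hd⟩ := hA.2 c
    refine ⟨monomial (k * 2) (-d), ?_⟩
    rw [expand_monomial, monomial_pow, ← map_sub, two_mul, ← map_add]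
    congr 1
    linear_combination -hd

theorem two_mem_nonZeroDivisors (hA : IsOneEven A) : (2 : A[X]) ∈ nonZeroDivisors A[X] := by
  rw [mem_nonZeroDivisors_iff_right]
  intro a ha
  ext k
  have h := congrArg (coeff · k) ha
  rw [mul_two, coeff_zero, coeff_add, ← mul_two] at h
  exact (mem_nonZeroDivisors_iff_right.1 hA.1) _ h

theorem two_cancel {R : Type u} [CommRing R] (hR : (2 : R) ∈ nonZeroDivisors R) {a b : R}
    (h : 2 * a = 2 * b) : a = b :=
  (mul_cancel_left_mem_nonZeroDivisors hR).1 h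

theorem cls_eq_zero (k : ℕ) (a : A) : cls k a = 0 ↔ ∃ c, a = k * c := by
  rw [cls, Ideal.Quotient.eq_zero_iff_mem, Ideal.mem_span_singleton]
  rfl

theorem red_eq_zero (k : ℕ) (a : A[X]) : red k a = 0 ↔ ∃ c, a = k * c := by
  have h : (∃ c, a = k * c) ↔ ∀ n, ((k : A)) ∣ a.coeff n := by
    rw [← C_dvd_iff_dvd_coeff]
    simp [dvd_def]
  rw [h, Polynomial.ext_iff]
  refine forall_congr' fun n => ?_
  rw [coeff_map, coeff_zero, Ideal.Quotient.eq_zero_iff_mem, Ideal.mem_span_singleton]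

theorem red_surjective (k : ℕ) : Function.Surjective (red k : A[X] → (ModBy A k)[X]) :=
  Polynomial.map_surjective _ Ideal.Quotient.mk_surjective

theorem red_eq_red (k : ℕ) {a b : A[X]} (c : A[X]) (h : a = b + k * c) : red k a = red k b := by
  rw [← sub_eq_zero, ← Polynomial.map_sub, red_eq_zero]
  exact ⟨c, by rw [h]; ring⟩

end DyadicPoly

/-! ### The numerators and denominators for `u = x`. -/

namespace DyadicPoly

variable {A : Type u} [CommRing A]

/-- This linearises `b ↦ b²x` modulo 2 and brings the three subgroups within reach of `foldOdd`. -/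
theorem exists_sq_mul_X (hA : IsOneEven A) (b : A[X]) :
    ∃ d, b ^ 2 * X = X * expand A 2 b + 2 * d := by
  obtain ⟨d, hd⟩ := two_dvd_sq_sub_expand hA b
  exact ⟨d * X, by linear_combination X * hd⟩

theorem exists_foldOdd_sub_sq (hA : IsOneEven A) (b : A[X]) :
    ∃ d, foldOdd (b - b ^ 2 * X) = 2 * d := by
  obtain ⟨d, hd⟩ := exists_sq_mul_X hA b
  refine ⟨-foldOdd d, ?_⟩
  rw [hd, map_sub, map_add, foldOdd_X_mul_expand, foldOdd_two_mul]
  ring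

/-- Since `c² ≡ expand A 2 c` mod 2, folding undoes the squaring. This is what makes the connecting
maps linear in `c`. -/
theorem exists_foldOdd_sq (hA : IsOneEven A) (c : A[X]) : ∃ d, foldOdd (c ^ 2) = c + 2 * d := by
  obtain ⟨d, hd⟩ := two_dvd_sq_sub_expand hA c
  refine ⟨foldOdd d, ?_⟩
  rw [← foldOdd_two_mul, ← hd, map_sub, foldOdd_expand]
  ring

theorem mem_denNeg_X_iff (hA : IsOneEven A) (a : A[X]) :
    a ∈ Explicit.denNeg (X : A[X]) ↔ ∃ d, foldOdd a = 2 * d := by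
  constructor
  · rintro ⟨b, c, rfl⟩
    obtain ⟨d, hd⟩ := exists_foldOdd_sub_sq hA b
    exact ⟨foldOdd c + d, by rw [map_add, hd, foldOdd_two_mul]; ring⟩
  · rintro ⟨d, hd⟩
    obtain ⟨b, hb⟩ := exists_sub_expand_foldOdd a
    obtain ⟨e, he⟩ := exists_sq_mul_X hA b
    have h2 : expand A 2 (2 * d) = 2 * expand A 2 d := by rw [two_mul, two_mul, map_add]
    rw [hd, h2] at hb
    exact ⟨b, expand A 2 d + e, by linear_combination hb + he⟩

theorem mem_num_X_iff (hA : IsOneEven A) (a : A[X]) :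
    a ∈ Explicit.num (X : A[X]) ↔ ∃ b, a = 2 * b := by
  constructor
  · rintro ⟨c, hc⟩
    obtain ⟨e, he⟩ := exists_sq_mul_X hA a
    exact two_dvd_of_sub_X_mul_expand ⟨c + e, by linear_combination hc + he⟩
  · rintro ⟨b, rfl⟩
    exact ⟨b - 2 * b ^ 2 * X, by ring⟩

/-- After cancelling 2 the question is whether `b ∈ 4R + {2(β - β²x)}`. Such elements are even, and
fold to multiples of 4 because `β - β²x` folds to an even polynomial. -/
theorem two_mul_mem_denZero_X_iff (hA : IsOneEven A) (b : A[X]) :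
    2 * b ∈ Explicit.denZero (X : A[X]) ↔
      (∃ d, foldOdd b = 4 * d) ∧ ∃ d, oddPart b = 2 * d := by
  have h2 := two_mem_nonZeroDivisors hA
  have h4 : ∀ c : A[X], foldOdd (4 * c) = 4 * foldOdd c := fun c => by
    rw [show 4 * c = 2 * (2 * c) by ring, foldOdd_two_mul, foldOdd_two_mul]; ring
  constructor
  · rintro ⟨β, c, h⟩
    obtain rfl : b = 4 * c + 2 * (β - β ^ 2 * X) := two_cancel h2 (by rw [h]; ring)
    obtain ⟨d, hd⟩ := exists_foldOdd_sub_sq hA β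
    refine ⟨⟨foldOdd c + d, ?_⟩, ⟨oddPart (2 * c + (β - β ^ 2 * X)), ?_⟩⟩
    · rw [map_add, h4, foldOdd_two_mul, hd]; ring
    · rw [← oddPart_two_mul]
      congr 1
      ring
  · rintro ⟨⟨d, hd⟩, ⟨e, he⟩⟩
    obtain ⟨β, hβ⟩ := exists_sub_expand_foldOdd b
    -- For the converse, the odd part of the decomposition of `b` shows `β ≡ oddPart β` mod 2, which
    -- forces `β` to be even; half of it is the required parameter.
    have h3 : oddPart b = oddPart β - β := by
      conv_lhs => rw [hβ]
      rw [oddPart_add, oddPart_sub, oddPart_expand, oddPart_X_mul_expand, zero_add]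
    obtain ⟨β', rfl⟩ : 2 ∣ β :=
      two_dvd_of_sub_oddPart ⟨-e, by linear_combination -he + h3⟩
    obtain ⟨r, hr⟩ := exists_sq_mul_X hA β'
    have h5 : expand A 2 (4 * d) = 4 * expand A 2 d := by
      rw [map_mul]; congr 1; exact map_ofNat _ 4
    have h6 : expand A 2 (2 * β') = 2 * expand A 2 β' := by
      rw [map_mul]; congr 1; exact map_ofNat _ 2
    rw [hd, h5, h6] at hβ
    exact ⟨β', expand A 2 d + r, by linear_combination 2 * hβ + 4 * hr⟩

/-! ### Reduction of `u = 1` to constants and `u = x`. -/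

theorem exists_eq_C_add (a : A[X]) : ∃ r p, a = C r + X * p :=
  ⟨a.coeff 0, divX a, by rw [add_comm, X_mul_divX_add]⟩

theorem coeff_zero_C_add (r : A) (p : A[X]) : (C r + X * p).coeff 0 = r := by simp

theorem divX_C_add (r : A) (p : A[X]) : divX (C r + X * p) = p := by
  ext k
  simp [coeff_divX, coeff_X_mul, coeff_C_succ]

theorem ofNat_mul_C_add (r : A) (p : A[X]) (k : ℕ) [k.AtLeastTwo] :
    (OfNat.ofNat k : A[X]) * (C r + X * p) = C (OfNat.ofNat k * r) + X * (OfNat.ofNat k * p) := by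
  rw [map_mul, map_ofNat]; ring

theorem C_add_X_mul_inj {r s : A} {p q : A[X]} (h : C r + X * p = C s + X * q) :
    r = s ∧ p = q := by
  constructor
  · simpa using congrArg (coeff · 0) h
  · ext k
    simpa using congrArg (coeff · (k + 1)) h

/-- Dividing the positive-degree part by `X` turns `a - a²` into `p - p²X`, up to the even cross
term `2rp`. The factor `1` keeps the form `a²u` of the definitions. -/
theorem sub_sq_C_add (r : A) (p : A[X]) : (C r + X * p) - (C r + X * p) ^ 2 * 1 =
    C (r - r ^ 2) + X * (p - p ^ 2 * X - 2 * (C r * p)) := by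
  rw [map_sub, map_pow]; ring

theorem mem_denNeg_one_iff (hA : IsOneEven A) (r : A) (p : A[X]) :
    C r + X * p ∈ Explicit.denNeg (1 : A[X]) ↔
      (∃ s, r = 2 * s) ∧ p ∈ Explicit.denNeg (X : A[X]) := by
  constructor
  · rintro ⟨b, c, h⟩
    obtain ⟨s, b, rfl⟩ := exists_eq_C_add b
    obtain ⟨t, c, rfl⟩ := exists_eq_C_add c
    rw [sub_sq_C_add, ofNat_mul_C_add, add_add_add_comm, ← map_add, ← mul_add] at h
    obtain ⟨h1, h2⟩ := C_add_X_mul_inj h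
    obtain ⟨w, hw⟩ := hA.2 s
    exact ⟨⟨t + w, by linear_combination h1 + hw⟩, ⟨b, c - C s * b, by rw [h2]; ring⟩⟩
  · rintro ⟨⟨s, rfl⟩, ⟨b, c, rfl⟩⟩
    refine ⟨X * b, C s + X * c, ?_⟩
    rw [map_mul, map_ofNat]
    ring

theorem mem_num_one_iff (hA : IsOneEven A) (r : A) (p : A[X]) :
    C r + X * p ∈ Explicit.num (1 : A[X]) ↔ p ∈ Explicit.num (X : A[X]) := by
  constructor
  · rintro ⟨c, h⟩
    obtain ⟨t, c, rfl⟩ := exists_eq_C_add c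
    rw [sub_sq_C_add, ofNat_mul_C_add] at h
    obtain ⟨h1, h2⟩ := C_add_X_mul_inj h
    exact ⟨c + C r * p, by linear_combination h2⟩
  · rintro ⟨c, h⟩
    obtain ⟨w, hw⟩ := hA.2 r
    refine ⟨C w + X * (c - C r * p), ?_⟩
    rw [sub_sq_C_add, ofNat_mul_C_add, h, hw]
    ring

/-- On constants, `4(s - s²) ∈ 8A` by 1-evenness, so only `8A` is divided out; this is the source of
the summand `A_8`. -/
theorem mem_denZero_one_iff (hA : IsOneEven A) (r : A) (p : A[X]) :
    C r + X * p ∈ Explicit.denZero (1 : A[X]) ↔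
      (∃ s, r = 8 * s) ∧ p ∈ Explicit.denZero (X : A[X]) := by
  constructor
  · rintro ⟨b, c, h⟩
    obtain ⟨s, b, rfl⟩ := exists_eq_C_add b
    obtain ⟨t, c, rfl⟩ := exists_eq_C_add c
    have e : 4 * (C s + X * b) - 4 * (C s + X * b) ^ 2 * 1 =
        4 * ((C s + X * b) - (C s + X * b) ^ 2 * 1) := by ring
    rw [e, sub_sq_C_add, ofNat_mul_C_add, ofNat_mul_C_add, add_add_add_comm, ← map_add, ← mul_add] at h
    obtain ⟨h1, h2⟩ := C_add_X_mul_inj h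
    obtain ⟨w, hw⟩ := hA.2 s
    exact ⟨⟨t + w, by linear_combination h1 + 4 * hw⟩, ⟨b, c - C s * b, by rw [h2]; ring⟩⟩
  · rintro ⟨⟨s, rfl⟩, ⟨b, c, rfl⟩⟩
    refine ⟨X * b, C s + X * c, ?_⟩
    rw [map_mul, map_ofNat]
    ring

theorem mem_denOne_iff (a : A[X]) : a ∈ Explicit.denOne A[X] ↔ ∃ b, a = 2 * b :=
  ⟨fun ⟨b, hb⟩ => ⟨b, hb.symm⟩, fun ⟨b, hb⟩ => ⟨b, hb.symm⟩⟩

/-! ### The explicit isomorphisms onto polynomial groups. -/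

theorem exists_equiv_of_hom {G H : Type*} [AddCommGroup G] [AddCommGroup H] (N : AddSubgroup G)
    (f : G →+ H) (hf : Function.Surjective f) (hN : ∀ g, g ∈ N ↔ f g = 0) :
    ∃ e : G ⧸ N ≃+ H, ∀ g, e (QuotientAddGroup.mk g) = f g :=
  ⟨QuotientAddGroup.liftEquiv N hf (AddSubgroup.ext hN), fun _ => rfl⟩

theorem exists_QNeg_X (hA : IsOneEven A) :
    ∃ e : Explicit.QNeg (X : A[X]) ≃+ (ModBy A 2)[X],
      ∀ a, e (QuotientAddGroup.mk a) = red 2 (foldOdd a) := by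
  refine exists_equiv_of_hom _
    ((mapRingHom (Ideal.Quotient.mk _)).toAddMonoidHom.comp foldOdd.toAddMonoidHom) ?_ ?_
  · intro y
    obtain ⟨y, rfl⟩ := red_surjective 2 y
    exact ⟨expand A 2 y, congrArg (red 2) (foldOdd_expand y)⟩
  · intro a
    rw [mem_denNeg_X_iff hA]
    exact (red_eq_zero 2 (foldOdd a)).symm

theorem exists_QNeg_one (hA : IsOneEven A) :
    ∃ e : Explicit.QNeg (1 : A[X]) ≃+ (ModBy A 2)[X],
      ∀ r p, e (QuotientAddGroup.mk (C r + X * p)) = C (cls 2 r) + X * red 2 (foldOdd p) := by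
  refine Exists.imp (fun e he => ?_) <| exists_equiv_of_hom (Explicit.denNeg (1 : A[X])) (AddMonoidHom.mk'
    (fun a => C (cls 2 (a.coeff 0)) + X * red 2 (foldOdd (divX a)))
    (by
      intro a b
      simp only [coeff_add, divX_add, map_add, Polynomial.map_add]
      ring)) ?_ ?_
  · intro r p
    rw [he, AddMonoidHom.mk'_apply, coeff_zero_C_add, divX_C_add]
  · intro y
    obtain ⟨y, rfl⟩ := red_surjective 2 y
    obtain ⟨r, p, rfl⟩ := exists_eq_C_add y
    refine ⟨C r + X * expand A 2 p, ?_⟩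
    rw [AddMonoidHom.mk'_apply, coeff_zero_C_add, divX_C_add, foldOdd_expand]
    simp only [red, Polynomial.map_add, Polynomial.map_mul, map_C, map_X]
  · intro a
    obtain ⟨r, p, rfl⟩ := exists_eq_C_add a
    rw [mem_denNeg_one_iff hA, mem_denNeg_X_iff hA]
    have h1 := cls_eq_zero 2 r
    have h2 := red_eq_zero 2 (foldOdd p)
    simp only [Nat.cast_ofNat] at h1 h2
    rw [← h1, ← h2]
    rw [AddMonoidHom.mk'_apply, coeff_zero_C_add, divX_C_add]
    constructor
    · rintro ⟨h, h'⟩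
      rw [h, h']; simp
    · intro h
      exact C_add_X_mul_inj (h.trans (by simp : (0 : (ModBy A 2)[X]) = C 0 + X * 0))

/-- Halves are unique because 2 is not a zero divisor, and uniqueness makes the chosen halving
additive. -/
theorem exists_half (hA : IsOneEven A) :
    ∃ f : Explicit.num (X : A[X]) →+ A[X], ∀ a, a.1 = 2 * f a := by
  choose f hf using fun a : Explicit.num (X : A[X]) => (mem_num_X_iff hA a.1).1 a.2
  refine ⟨AddMonoidHom.mk' f fun a b => two_cancel (two_mem_nonZeroDivisors hA) ?_, hf⟩
  rw [← hf, mul_add, ← hf, ← hf]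
  rfl

/-- The additive map `b ↦ (foldOdd b mod 4, oddPart b mod 2)`. -/
noncomputable def foldPair (A : Type u) [CommRing A] :
    A[X] →+ (ModBy A 4)[X] × (ModBy A 2)[X] :=
  AddMonoidHom.mk' (fun b => (red 4 (foldOdd b), red 2 (oddPart b)))
    (by
      intro a b
      rw [map_add, oddPart_add, Prod.mk_add_mk, ← Polynomial.map_add, ← Polynomial.map_add])

theorem foldPair_apply (b : A[X]) : foldPair A b = (red 4 (foldOdd b), red 2 (oddPart b)) := rfl

theorem foldPair_surjective : Function.Surjective (foldPair A) := by
  rintro ⟨y, z⟩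
  obtain ⟨y, rfl⟩ := red_surjective 4 y
  obtain ⟨z, rfl⟩ := red_surjective 2 z
  -- The first term has odd part `z` and fold `foldOdd z`; the second corrects the fold in even
  -- degrees, unseen by `oddPart`.
  refine ⟨X * expand A 2 z + expand A 2 (y - foldOdd z), ?_⟩
  rw [foldPair_apply, map_add, foldOdd_X_mul_expand, foldOdd_expand, oddPart_add, oddPart_expand,
    oddPart_X_mul_expand, add_zero, add_sub_cancel]

theorem foldPair_eq_zero_iff (hA : IsOneEven A) (b : A[X]) :
    2 * b ∈ Explicit.denZero (X : A[X]) ↔ foldPair A b = 0 := by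
  rw [two_mul_mem_denZero_X_iff hA, foldPair_apply, Prod.mk_eq_zero, red_eq_zero, red_eq_zero]
  rfl

theorem exists_QZero_X (hA : IsOneEven A) :
    ∃ e : Explicit.QZero (X : A[X]) ≃+ (ModBy A 4)[X] × (ModBy A 2)[X],
      ∀ a b, a.1 = 2 * b → e (QuotientAddGroup.mk a) = foldPair A b := by
  obtain ⟨f, hf⟩ := exists_half hA
  refine Exists.imp (fun e he => ?_) <| exists_equiv_of_hom
    ((Explicit.denZero (X : A[X])).addSubgroupOf (Explicit.num X)) ((foldPair A).comp f) ?_ ?_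
  · intro a b hab
    rw [he, AddMonoidHom.comp_apply, two_cancel (two_mem_nonZeroDivisors hA) ((hf a).symm.trans hab)]
  · intro y
    obtain ⟨b, rfl⟩ := foldPair_surjective y
    refine ⟨⟨2 * b, (mem_num_X_iff hA _).2 ⟨b, rfl⟩⟩, ?_⟩
    rw [AddMonoidHom.comp_apply, ← two_cancel (two_mem_nonZeroDivisors hA) (hf ⟨2 * b, _⟩)]
  · intro a
    rw [AddSubgroup.mem_addSubgroupOf, hf a, foldPair_eq_zero_iff hA]
    rfl

theorem divX_mem_num (hA : IsOneEven A) {a : A[X]} (ha : a ∈ Explicit.num (1 : A[X])) :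
    divX a ∈ Explicit.num (X : A[X]) := by
  obtain ⟨r, p, rfl⟩ := exists_eq_C_add a
  rwa [divX_C_add, ← mem_num_one_iff hA r]

theorem exists_QZero_one (hA : IsOneEven A) :
    ∃ e : Explicit.QZero (1 : A[X]) ≃+ ModBy A 8 × (ModBy A 4)[X] × (ModBy A 2)[X],
      ∀ a r b, a.1 = C r + X * (2 * b) → e (QuotientAddGroup.mk a) = (cls 8 r, foldPair A b) := by
  obtain ⟨f, hf⟩ := exists_half hA
  -- Identifies the chosen half of `divX a` with any explicitly given one, so that the isomorphism
  -- can be evaluated without the choice.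
  have key : ∀ (a : Explicit.num (1 : A[X])) r b, a.1 = C r + X * (2 * b) →
      f ⟨divX a.1, divX_mem_num hA a.2⟩ = b := by
    intro a r b h
    refine two_cancel (two_mem_nonZeroDivisors hA) ?_
    rw [← hf]
    change divX a.1 = _
    rw [h, divX_C_add]
  refine Exists.imp (fun e he => ?_) <| exists_equiv_of_hom
    ((Explicit.denZero (1 : A[X])).addSubgroupOf (Explicit.num 1))
    (AddMonoidHom.mk' (fun a => (cls 8 (a.1.coeff 0),
      foldPair A (f ⟨divX a.1, divX_mem_num hA a.2⟩)))
      (by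
        intro a b
        rw [Prod.mk_add_mk, ← map_add, ← map_add, ← map_add]
        refine Prod.ext (congrArg (cls 8) (coeff_add a.1 b.1 0)) ?_
        exact congrArg (fun t => foldPair A (f t)) (Subtype.ext divX_add))) ?_ ?_
  · intro a r b hab
    rw [he, AddMonoidHom.mk'_apply, key a r b hab, hab, coeff_zero_C_add]
  · rintro ⟨x, y⟩
    obtain ⟨b, rfl⟩ := foldPair_surjective y
    obtain ⟨r, rfl⟩ := Ideal.Quotient.mk_surjective x
    have hmem : C r + X * (2 * b) ∈ Explicit.num (1 : A[X]) :=
      (mem_num_one_iff hA _ _).2 ((mem_num_X_iff hA _).2 ⟨b, rfl⟩)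
    refine ⟨⟨_, hmem⟩, ?_⟩
    rw [AddMonoidHom.mk'_apply, key ⟨_, hmem⟩ r b rfl, coeff_zero_C_add]
  · intro a
    obtain ⟨r, p, hrp⟩ := exists_eq_C_add a.1
    have ha := a.2
    rw [hrp, mem_num_one_iff hA, mem_num_X_iff hA] at ha
    obtain ⟨b, rfl⟩ := ha
    have h8 := cls_eq_zero 8 r
    rw [AddSubgroup.mem_addSubgroupOf, AddMonoidHom.mk'_apply, key a r b hrp, hrp,
      mem_denZero_one_iff hA, coeff_zero_C_add, Prod.mk_eq_zero, foldPair_eq_zero_iff hA, h8]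
    rfl

theorem exists_QOne_one (hA : IsOneEven A) :
    ∃ e : Explicit.QOne (1 : A[X]) ≃+ ModBy A 2,
      ∀ a, e (QuotientAddGroup.mk a) = cls 2 (a.1.coeff 0) := by
  refine exists_equiv_of_hom _ (AddMonoidHom.mk' (fun a : Explicit.num (1 : A[X]) => cls 2 (a.1.coeff 0))
    (fun a b => by rw [← map_add, ← coeff_add]; rfl)) ?_ ?_
  · intro x
    obtain ⟨r, rfl⟩ := Ideal.Quotient.mk_surjective x
    refine ⟨⟨C r + X * 0, (mem_num_one_iff hA _ _).2 (zero_mem _)⟩, ?_⟩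
    rw [AddMonoidHom.mk'_apply, coeff_zero_C_add]
  · intro a
    obtain ⟨r, p, hrp⟩ := exists_eq_C_add a.1
    have ha := a.2
    rw [hrp, mem_num_one_iff hA, mem_num_X_iff hA] at ha
    obtain ⟨b, rfl⟩ := ha
    rw [AddSubgroup.mem_addSubgroupOf, AddMonoidHom.mk'_apply, hrp, mem_denOne_iff,
      coeff_zero_C_add, cls_eq_zero]
    constructor
    · rintro ⟨c, hc⟩
      obtain ⟨t, c, rfl⟩ := exists_eq_C_add c
      rw [ofNat_mul_C_add] at hc
      exact ⟨t, (C_add_X_mul_inj hc).1⟩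
    · rintro ⟨t, rfl⟩
      refine ⟨C t + X * b, ?_⟩
      rw [ofNat_mul_C_add]
      rfl

theorem subsingleton_QOne_X (hA : IsOneEven A) : Subsingleton (Explicit.QOne (X : A[X])) := by
  have h : (Explicit.denOne A[X]).addSubgroupOf (Explicit.num (X : A[X])) = ⊤ := by
    refine eq_top_iff.2 fun a _ => ?_
    rw [AddSubgroup.mem_addSubgroupOf, mem_denOne_iff]
    exact (mem_num_X_iff hA _).1 a.2
  rw [Explicit.QOne, h]
  exact QuotientAddGroup.subsingleton_quotient_top

theorem red_foldOdd_sq (hA : IsOneEven A) (c : A[X]) : red 2 (foldOdd (c ^ 2)) = red 2 c := by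
  obtain ⟨d, hd⟩ := exists_foldOdd_sq hA c
  exact red_eq_red 2 d (by rw [hd]; rfl)

/-- With `foldOdd (c²) = c + 2d` the fold is `-2c - 4d`, and `-2c ≡ 2c` mod 4, so neither the sign
nor the square survives. The odd part is visibly even. -/
theorem foldPair_neg_two_mul_sq (hA : IsOneEven A) (c : A[X]) :
    foldPair A (-(2 * c ^ 2)) = (red 4 (2 * c), 0) := by
  obtain ⟨d, hd⟩ := exists_foldOdd_sq hA c
  rw [foldPair_apply]
  refine Prod.ext ?_ ?_
  · refine red_eq_red 4 (-(c + d)) ?_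
    rw [map_neg, foldOdd_two_mul, hd]
    push_cast
    ring
  · refine (red_eq_zero 2 _).2 ⟨oddPart (-c ^ 2), ?_⟩
    rw [Nat.cast_ofNat, ← oddPart_two_mul]
    congr 1
    ring

end DyadicPoly

/-! ### Scalar coordinates on families over the complex `2 : R → R`. -/

namespace BasedComplex

variable {R : Type u} [CommRing R]

/-- The entry of a matrix between terms of `C₁ R`, which is zero if one of the terms vanishes. -/
def entry {a b : ℤ} (M : Matrix ((C₁ R).ι a) ((C₁ R).ι b) R) : R := ∑ i, ∑ j, M i j

instance (a : ℤ) : Subsingleton ((C₁ R).ι a) :=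
  inferInstanceAs (Subsingleton {_i : Fin 1 // a = 0 ∨ a = 1})

theorem entry_eq {a b : ℤ} (M : Matrix ((C₁ R).ι a) ((C₁ R).ι b) R) (i j) : entry M = M i j := by
  rw [entry, Fintype.sum_subsingleton _ i, Fintype.sum_subsingleton _ j]

theorem entry_of_isEmpty_left {a b : ℤ} (M : Matrix ((C₁ R).ι a) ((C₁ R).ι b) R)
    (h : IsEmpty ((C₁ R).ι a)) : entry M = 0 := by
  rw [entry, Fintype.sum_empty]

theorem entry_of_isEmpty_right {a b : ℤ} (M : Matrix ((C₁ R).ι a) ((C₁ R).ι b) R)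
    (h : IsEmpty ((C₁ R).ι b)) : entry M = 0 :=
  Finset.sum_eq_zero fun _ _ => Fintype.sum_empty _

theorem entry_injective {a b : ℤ} :
    Function.Injective (entry : Matrix ((C₁ R).ι a) ((C₁ R).ι b) R → R) := by
  intro M N h
  ext i j
  rwa [entry_eq M i j, entry_eq N i j] at h

theorem entry_add {a b : ℤ} (M N : Matrix ((C₁ R).ι a) ((C₁ R).ι b) R) :
    entry (M + N) = entry M + entry N := by
  simp only [entry, Matrix.add_apply, Finset.sum_add_distrib]

theorem entry_zero {a b : ℤ} : entry (0 : Matrix ((C₁ R).ι a) ((C₁ R).ι b) R) = 0 := by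
  simp only [entry, Matrix.zero_apply, Finset.sum_const_zero]

theorem entry_smul {a b : ℤ} (ε : ℤˣ) (M : Matrix ((C₁ R).ι a) ((C₁ R).ι b) R) :
    entry (ε • M) = ε • entry M := by
  simp only [entry, Matrix.smul_apply, Finset.smul_sum]

theorem entry_transpose {a b : ℤ} (M : Matrix ((C₁ R).ι a) ((C₁ R).ι b) R) :
    entry M.transpose = entry M := Finset.sum_comm

/-- Every term has rank at most one, so a matrix product is a product of scalars; if a term is zero,
both sides vanish. -/
theorem entry_mul {a b c : ℤ} (M : Matrix ((C₁ R).ι a) ((C₁ R).ι b) R)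
    (N : Matrix ((C₁ R).ι b) ((C₁ R).ι c) R) : entry (M * N) = entry M * entry N := by
  rcases isEmpty_or_nonempty ((C₁ R).ι a) with ha | ⟨⟨i⟩⟩
  · rw [entry_of_isEmpty_left _ ha, entry_of_isEmpty_left _ ha, zero_mul]
  rcases isEmpty_or_nonempty ((C₁ R).ι c) with hc | ⟨⟨k⟩⟩
  · rw [entry_of_isEmpty_right _ hc, entry_of_isEmpty_right N hc, mul_zero]
  rcases isEmpty_or_nonempty ((C₁ R).ι b) with hb | ⟨⟨j⟩⟩
  · rw [entry_of_isEmpty_right M hb, zero_mul, entry_eq _ i k, Matrix.mul_apply, Fintype.sum_empty]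
  · rw [entry_eq _ i k, entry_eq _ i j, entry_eq _ j k, Matrix.mul_apply,
      Fintype.sum_subsingleton _ j]

theorem isEmpty_ι {a : ℤ} (h0 : a ≠ 0) (h1 : a ≠ 1) : IsEmpty ((C₁ R).ι a) :=
  ⟨fun i => i.2.elim h0 h1⟩

theorem entry_of_ne {a b : ℤ} (M : Matrix ((C₁ R).ι b) ((C₁ R).ι a) R)
    (h : ¬ ((a = 0 ∨ a = 1) ∧ (b = 0 ∨ b = 1))) : entry M = 0 := by
  rw [not_and_or, not_or, not_or] at h
  rcases h with h | h
  · exact entry_of_isEmpty_right _ (isEmpty_ι h.1 h.2)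
  · exact entry_of_isEmpty_left _ (isEmpty_ι h.1 h.2)

/-- The entry of the component `C^p → C_q`. -/
def comp (f : Fam (C₁ R) (C₁ R)) (p q : ℤ) : R := entry (f p q)

theorem c00_eq (f : Fam (C₁ R) (C₁ R)) : c00 f = comp f 0 0 := (entry_eq _ _ _).symm

theorem c01_eq (f : Fam (C₁ R) (C₁ R)) : c01 f = comp f 0 1 := (entry_eq _ _ _).symm

theorem comp_of_ne (f : Fam (C₁ R) (C₁ R)) {p q : ℤ}
    (h : ¬ ((p = 0 ∨ p = 1) ∧ (q = 0 ∨ q = 1))) : comp f p q = 0 := entry_of_ne _ h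

theorem apply_eq_zero_iff (f : Fam (C₁ R) (C₁ R)) (p q : ℤ) : f p q = 0 ↔ comp f p q = 0 := by
  rw [comp, ← entry_zero, entry_injective.eq_iff]

theorem fam_ext {f g : Fam (C₁ R) (C₁ R)} (h00 : comp f 0 0 = comp g 0 0)
    (h01 : comp f 0 1 = comp g 0 1) (h10 : comp f 1 0 = comp g 1 0)
    (h11 : comp f 1 1 = comp g 1 1) : f = g := by
  funext p q
  refine entry_injective ?_
  by_cases h : (p = 0 ∨ p = 1) ∧ (q = 0 ∨ q = 1)
  · rcases h with ⟨rfl | rfl, rfl | rfl⟩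
    exacts [h00, h01, h10, h11]
  · rw [entry_of_ne _ h, entry_of_ne _ h]

theorem fam_ext_iff {f g : Fam (C₁ R) (C₁ R)} : f = g ↔ comp f 0 0 = comp g 0 0 ∧
    comp f 0 1 = comp g 0 1 ∧ comp f 1 0 = comp g 1 0 ∧ comp f 1 1 = comp g 1 1 :=
  ⟨fun h => by simp [h], fun h => fam_ext h.1 h.2.1 h.2.2.1 h.2.2.2⟩

/-- The family with the given components `C^0 → C_0`, `C^0 → C_1`, `C^1 → C_0`, `C^1 → C_1`. -/
def mkFam (a b c e : R) : Fam (C₁ R) (C₁ R) := fun p q =>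
  Matrix.of fun _ _ => if p = 0 then if q = 0 then a else b else if q = 0 then c else e

theorem comp_mkFam_zero_zero (a b c e : R) : comp (mkFam a b c e) 0 0 = a :=
  entry_eq _ (bot R 0) (bot R 0)
theorem comp_mkFam_zero_one (a b c e : R) : comp (mkFam a b c e) 0 1 = b :=
  entry_eq _ (top R 0) (bot R 0)
theorem comp_mkFam_one_zero (a b c e : R) : comp (mkFam a b c e) 1 0 = c :=
  entry_eq _ (bot R 0) (top R 0)
theorem comp_mkFam_one_one (a b c e : R) : comp (mkFam a b c e) 1 1 = e :=
  entry_eq _ (top R 0) (top R 0)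

theorem comp_add (f g : Fam (C₁ R) (C₁ R)) (p q : ℤ) : comp (f + g) p q = comp f p q + comp g p q :=
  entry_add _ _

theorem comp_zero (p q : ℤ) : comp (0 : Fam (C₁ R) (C₁ R)) p q = 0 := entry_zero

/-- Taking the component `C^p → C_q` as an additive map. -/
def compHom (p q : ℤ) : Fam (C₁ R) (C₁ R) →+ R := AddMonoidHom.mk' (comp · p q)
  fun f g => comp_add f g p q

theorem comp_neg (f : Fam (C₁ R) (C₁ R)) (p q : ℤ) : comp (-f) p q = -comp f p q :=
  map_neg (compHom p q) f

theorem comp_sub (f g : Fam (C₁ R) (C₁ R)) (p q : ℤ) : comp (f - g) p q = comp f p q - comp g p q :=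
  map_sub (compHom p q) f g

theorem comp_smul (ε : ℤˣ) (f : Fam (C₁ R) (C₁ R)) (p q : ℤ) :
    comp (ε • f) p q = ε • comp f p q := entry_smul _ _

theorem entry_d (q r : ℤ) : entry ((C₁ R).d q r) = if q = 0 ∧ r = 1 then 2 else 0 := by
  split_ifs with h
  · obtain ⟨rfl, rfl⟩ := h
    exact entry_eq _ (bot R 0) (top R 0)
  · have : (C₁ R).d q r = 0 := by
      ext i j
      rw [cone_d_apply, if_neg (fun h' => h ⟨h'.1, h'.2.1⟩), Matrix.zero_apply]
    rw [this, entry_zero]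

theorem comp_dV (f : Fam (C₁ R) (C₁ R)) (p q : ℤ) : comp (dV _ _ f) p q =
    (if q = 0 then 2 * comp f p 1 else 0) +
      q.negOnePow • (if p = 0 then 2 * comp f 1 q else 0) := by
  rw [comp, dV_apply, entry_add, entry_smul, entry_mul, entry_mul, entry_transpose, entry_d,
    entry_d]
  congr 1
  · by_cases h : q = 0
    · subst h; simp [comp]
    · simp [h]
  · congr 1
    by_cases h : p = 0
    · subst h; simp [comp, mul_comm]
    · simp [h]

theorem comp_transp (f : Fam (C₁ R) (C₁ R)) (p q : ℤ) :
    comp (transp _ _ f) p q = (p * q).negOnePow • comp f q p := by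
  rw [comp, transp_apply, entry_smul, entry_transpose]; rfl

theorem comp_dHat (n : ℤ) (f : Fam (C₁ R) (C₁ R)) (p q : ℤ) : comp (dHat _ n f) p q =
    comp (dV _ _ f) p q + (p + q).negOnePow • comp f p q -
      n.negOnePow • (p * q).negOnePow • comp f q p := by
  rw [dHat_eq, comp_sub, comp_add, comp_smul, comp_transp]
  congr 2
  exact entry_smul _ _

theorem γ₁_apply (u : R) (a b : ℤ) (i j) : (γ₁ u).g a b i j =
    if a = 0 ∧ b = 0 then u else if b = 1 then 2 * u else 0 := by
  rw [show (γ₁ u).g a b i j = coneFam !![u] a b i j from rfl, coneFam_apply,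
    Subsingleton.elim i.1 0, Subsingleton.elim j.1 0]
  rfl

theorem entry_γ₁ (u : R) (a b : ℤ) : entry ((γ₁ u).g a b) =
    if a = 0 then (if b = 0 then u else if b = 1 then 2 * u else 0)
      else if a = 1 then (if b = 1 then 2 * u else 0) else 0 := by
  by_cases h : (a = 0 ∨ a = 1) ∧ (b = 0 ∨ b = 1)
  · rcases h with ⟨rfl | rfl, rfl | rfl⟩
    · exact (entry_eq _ (bot R 0) (bot R 0)).trans (by rw [γ₁_apply]; simp)
    · exact (entry_eq _ (top R 0) (bot R 0)).trans (by rw [γ₁_apply]; simp)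
    · exact (entry_eq _ (bot R 0) (top R 0)).trans (by rw [γ₁_apply]; simp)
    · exact (entry_eq _ (top R 0) (top R 0)).trans (by rw [γ₁_apply]; simp)
  · rw [entry_of_ne _ h]
    split_ifs <;> simp_all

variable (γ : ChainBundle (C₁ R)) (n : ℤ)

theorem comp_hatMap (f : Fam (C₁ R) (C₁ R)) (p q : ℤ) : comp (hatMap γ n f) p q =
    comp f (n - q) q * ((n * (n - q)).negOnePow • entry (γ.g (n - p) (n - q))) *
      comp f (n - p) p := by
  have h : hatMap γ n f p q = f (n - q) q * ((n * (n - q)).negOnePow • γ.g (n - p) (n - q)) *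
      (f (n - p) p).transpose := rfl
  rw [comp, h, entry_mul, entry_mul, entry_smul, entry_transpose]
  rfl

theorem comp_cross (f f' : Fam (C₁ R) (C₁ R)) (p q : ℤ) : comp (TwStr.cross γ n f f') p q =
    -(n.negOnePow • (comp f (n - q) q * ((p * q).negOnePow • (n * (n - p)).negOnePow •
      entry (γ.g (n - q) (n - p))) * comp f' (n - p) p)) := by
  have h : conj (chain n f) (chain n f') (transp _ _ (susp _ n γ.g)) p q =
      f (n - q) q * ((p * q).negOnePow •
        ((n * (n - p)).negOnePow • γ.g (n - q) (n - p)).transpose) * (f' (n - p) p).transpose := rfl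
  rw [TwStr.cross, sumTerm, comp_neg, comp_smul, comp, h, entry_mul, entry_mul, entry_smul,
    entry_transpose, entry_transpose, entry_smul]
  rfl

theorem comp_homTerm (x f f' : Fam (C₁ R) (C₁ R)) (p q : ℤ) :
    comp (TwStr.homTerm γ n x f f') p q =
      comp x (n - (q - 1)) q * ((n * (n - (q - 1))).negOnePow •
        entry (γ.g (n - p) (n - (q - 1)))) * comp f (n - p) p +
      q.negOnePow • (comp f' (n - q) q * ((n * (n - q)).negOnePow •
        entry (γ.g (n - (p - 1)) (n - q))) * comp x (n - (p - 1)) p) +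
      n.negOnePow • (q - 1).negOnePow • (comp x (n - (q - 1)) q *
        (((p - 1) * (q - 1)).negOnePow • (n * (n - (p - 1))).negOnePow •
          entry (γ.g (n - (q - 1)) (n - (p - 1)))) * comp x (n - (p - 1)) p) := by
  have h1 : hL (homot n x) (chain n f) (susp _ n γ.g) p q =
      x (n - (q - 1)) q * ((n * (n - (q - 1))).negOnePow • γ.g (n - p) (n - (q - 1))) *
        (f (n - p) p).transpose := rfl
  have h2 : hR (chain n f') (homot n x) (susp _ n γ.g) p q =
      q.negOnePow • (f' (n - q) q * ((n * (n - q)).negOnePow • γ.g (n - (p - 1)) (n - q)) *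
        (x (n - (p - 1)) p).transpose) := rfl
  have h3 : hM (homot n x) (homot n x) (transp _ _ (susp _ n γ.g)) p q =
      (q - 1).negOnePow • (x (n - (q - 1)) q * (((p - 1) * (q - 1)).negOnePow •
        ((n * (n - (p - 1))).negOnePow • γ.g (n - (q - 1)) (n - (p - 1))).transpose) *
          (x (n - (p - 1)) p).transpose) := rfl
  rw [TwStr.homTerm, homotopyTerm, comp_add, comp_add, comp_smul, comp, comp, comp, h1, h2, h3]
  simp only [entry_mul, entry_smul, entry_transpose]
  rfl

theorem negOnePow_two : Int.negOnePow 2 = 1 := rfl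

section

variable (f : Fam (C₁ R) (C₁ R))

theorem comp_dHat_zero_zero : comp (dHat _ n f) 0 0 =
    2 * (comp f 0 1 + comp f 1 0) + comp f 0 0 - n.negOnePow • comp f 0 0 := by
  simp [comp_dHat, comp_dV]; ring

theorem comp_dHat_zero_one : comp (dHat _ n f) 0 1 =
    -2 * comp f 1 1 - comp f 0 1 - n.negOnePow • comp f 1 0 := by
  simp [comp_dHat, comp_dV]; ring

theorem comp_dHat_one_zero : comp (dHat _ n f) 1 0 =
    2 * comp f 1 1 - comp f 1 0 - n.negOnePow • comp f 0 1 := by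
  simp [comp_dHat, comp_dV]; ring

theorem comp_dHat_one_one : comp (dHat _ n f) 1 1 =
    comp f 1 1 + n.negOnePow • comp f 1 1 := by
  simp [comp_dHat, comp_dV, negOnePow_two]

end

end BasedComplex

/-! ### The bundle terms in low degrees. -/

namespace BasedComplex

variable {R : Type u} [CommRing R] (u : R)

section Components

variable (f f' x : Fam (C₁ R) (C₁ R))

/-- In degree 0 the map `φ_0` has only the component `C^0 → C_0`, since `(-q, q)` lies in `{0, 1}²`
only for `q = 0`. In degree 1 both mixed components contribute. -/
theorem hatMap_zero_eq : hatMap (γ₁ u) 0 f = mkFam (u * comp f 0 0 ^ 2) 0 0 0 := by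
  refine fam_ext ?_ ?_ ?_ ?_ <;>
    simp [comp_hatMap, entry_γ₁, comp_mkFam_zero_zero, comp_mkFam_zero_one, comp_mkFam_one_zero,
      comp_mkFam_one_one, comp_of_ne]
  ring

theorem hatMap_one_eq : hatMap (γ₁ u) 1 f = mkFam (-(2 * u * comp f 1 0 ^ 2)) 0
    (-(2 * u * comp f 1 0 * comp f 0 1)) (u * comp f 0 1 ^ 2) := by
  refine fam_ext ?_ ?_ ?_ ?_ <;>
    simp [comp_hatMap, entry_γ₁, comp_mkFam_zero_zero, comp_mkFam_zero_one, comp_mkFam_one_zero,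
      comp_mkFam_one_one] <;>
  ring

/-- No pair `(-1 - q, q)` lies in `{0, 1}²`, so `φ_0 = 0`. -/
theorem hatMap_neg_one_eq : hatMap (γ₁ u) (-1) f = 0 := by
  refine fam_ext ?_ ?_ ?_ ?_ <;> simp [comp_hatMap, comp_of_ne, comp_zero]

theorem cross_zero_eq : TwStr.cross (γ₁ u) 0 f f' =
    mkFam (-(u * comp f 0 0 * comp f' 0 0)) 0 0 0 := by
  refine fam_ext ?_ ?_ ?_ ?_ <;>
    simp [comp_cross, entry_γ₁, comp_mkFam_zero_zero, comp_mkFam_zero_one, comp_mkFam_one_zero,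
      comp_mkFam_one_one, comp_of_ne]
  ring

theorem cross_neg_one_eq : TwStr.cross (γ₁ u) (-1) f f' = 0 := by
  refine fam_ext ?_ ?_ ?_ ?_ <;> simp [comp_cross, comp_of_ne, comp_zero]

/-- Only the term quadratic in the homotopy survives, as the chain maps vanish in this degree. It
supplies the `b²u` in the denominator of `Q_{-1}`. -/
theorem homTerm_neg_one_eq : TwStr.homTerm (γ₁ u) (-1) x f f' =
    mkFam (-(u * comp x 0 0 ^ 2)) 0 0 0 := by
  refine fam_ext ?_ ?_ ?_ ?_ <;>
    simp [comp_homTerm, entry_γ₁, comp_mkFam_zero_zero, comp_mkFam_zero_one, comp_mkFam_one_zero,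
      comp_mkFam_one_one, comp_of_ne, negOnePow_two]
  ring

theorem homTerm_zero_eq : TwStr.homTerm (γ₁ u) 0 x f f' =
    mkFam (2 * u * comp x 1 0 * comp f 0 0 + 2 * u * comp x 1 0 ^ 2)
      (u * comp x 0 1 * comp f 0 0 + 2 * u * comp x 0 1 * comp x 1 0)
      (u * comp f' 0 0 * comp x 0 1) (u * comp x 0 1 ^ 2) := by
  refine fam_ext ?_ ?_ ?_ ?_ <;>
    simp [comp_homTerm, entry_γ₁, comp_mkFam_zero_zero, comp_mkFam_zero_one, comp_mkFam_one_zero,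
      comp_mkFam_one_one, comp_of_ne] <;>
  ring

end Components

end BasedComplex

/-! ### The group `Q_{-1}(C(u), γ(u))`. -/

namespace BasedComplex

variable {R : Type u} [CommRing R]

/-- Additivity of `F` reduces injectivity on classes to recognising structures equivalent to `0`. -/
theorem exists_equiv_of_twStr_hom {C : BasedComplex R} {γ : ChainBundle C} {n : ℤ} {H : Type*}
    [AddCommGroup H] (F : TwStr γ n →+ H) (hF : Function.Surjective F)
    (h₁ : ∀ s t, TwStr.Equivalent s t → F s = F t) (h₂ : ∀ s, F s = 0 → TwStr.Equivalent s 0) :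
    ∃ e : TwistedQ γ n ≃+ H, ∀ s, e (TwistedQ.mk s) = F s := by
  let L : TwistedQ γ n →+ H := (TwStr.con γ n).lift F fun s t h => h₁ s t h
  have hL : ∀ s, L (TwistedQ.mk s) = F s := fun _ => rfl
  refine ⟨AddEquiv.ofBijective L ⟨?_, fun y => ?_⟩, hL⟩
  · rw [injective_iff_map_eq_zero]
    intro x hx
    induction x using AddCon.induction_on with
    | H s => exact (AddCon.eq _).2 (h₂ s hx)
  · obtain ⟨s, rfl⟩ := hF y
    exact ⟨TwistedQ.mk s, rfl⟩

theorem mem_symChains {n : ℤ} {f : Fam (C₁ R) (C₁ R)}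
    (h : ∀ p q, (p = 0 ∨ p = 1) → (q = 0 ∨ q = 1) → p + q < n → comp f p q = 0) :
    f ∈ symChains (C₁ R) n := by
  intro p q hpq
  rw [apply_eq_zero_iff]
  by_cases h' : (p = 0 ∨ p = 1) ∧ (q = 0 ∨ q = 1)
  · exact h p q h'.1 h'.2 hpq
  · exact comp_of_ne _ h'

theorem comp_eq_zero_of_mem {n : ℤ} {f : Fam (C₁ R) (C₁ R)} (h : f ∈ symChains (C₁ R) n) {p q : ℤ}
    (hpq : p + q < n) : comp f p q = 0 := (apply_eq_zero_iff _ _ _).1 (h p q hpq)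

/-- As `φ = dθ`, the structure is just `θ`, and `ξ` is unrestricted because all components have `p +
q ≥ 0`. Thus `ξ` can kill every entry of `θ` except the one at `(0, 0)`, where `ξ` acts through `ξ₀₀
+ uξ₀₀²` and `dη` through even elements. -/
theorem exists_equiv_neg_one (u : R) : ∃ e : TwistedQ (γ₁ u) (-1) ≃+ Explicit.QNeg u,
    ∀ s, e (TwistedQ.mk s) = QuotientAddGroup.mk (c00 s.θ) := by
  refine exists_equiv_of_twStr_hom (AddMonoidHom.mk'
    (fun s => (QuotientAddGroup.mk (c00 s.θ) : Explicit.QNeg u)) ?_) ?_ ?_ ?_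
  · intro s t
    rw [← QuotientAddGroup.mk_add, TwStr.add_θ, cross_neg_one_eq, add_zero]
    rfl
  · intro y
    obtain ⟨a, rfl⟩ := QuotientAddGroup.mk_surjective y
    refine ⟨⟨dHat _ (-1 + 1) (mkFam a 0 0 0), mkFam a 0 0 0, ⟨?_, ?_⟩, ?_⟩, ?_⟩
    · exact mem_symChains fun p q hp hq h => by omega
    · exact dHat_dHat _ _ _
    · rw [hatMap_neg_one_eq, sub_zero]
    · rw [AddMonoidHom.mk'_apply, c00_eq, comp_mkFam_zero_zero]
  · rintro s t ⟨ξ, η, -, -, h⟩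
    rw [AddMonoidHom.mk'_apply, QuotientAddGroup.eq, c00_eq, c00_eq]
    have h0 := (fam_ext_iff.1 h).1
    rw [homTerm_neg_one_eq] at h0
    simp [comp_dHat_zero_zero, comp_add, comp_sub, comp_mkFam_zero_zero] at h0
    refine ⟨comp ξ 0 0, comp η 0 1 + comp η 1 0 + comp η 0 0 + u * comp ξ 0 0 ^ 2, ?_⟩
    linear_combination -h0
  · intro s hs
    rw [AddMonoidHom.mk'_apply, QuotientAddGroup.eq_zero_iff, c00_eq] at hs
    obtain ⟨b, c, h⟩ := hs
    have hφ := s.dθ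
    rw [hatMap_neg_one_eq, sub_zero] at hφ
    -- The differential from degree 0 ignores the entry at `(0, 0)`, so `ξ` may differ from `-θ`
    -- there and still satisfy `dξ = -φ`.
    refine ⟨mkFam (-b) (-comp s.θ 0 1) (-comp s.θ 1 0) (-comp s.θ 1 1), mkFam (-c) 0 0 0,
      mem_symChains fun p q hp hq h => by omega, ?_, ?_⟩
    · rw [← hφ]
      change _ = 0 - _
      refine fam_ext ?_ ?_ ?_ ?_ <;>
      simp [comp_dHat_zero_zero, comp_dHat_zero_one, comp_dHat_one_zero, comp_dHat_one_one, comp_neg,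
        comp_mkFam_zero_zero, comp_mkFam_zero_one, comp_mkFam_one_zero, comp_mkFam_one_one] <;>
      ring
    · rw [homTerm_neg_one_eq]
      change _ = 0 - _ - _ + _
      refine fam_ext ?_ ?_ ?_ ?_ <;>
      simp [comp_dHat_zero_zero, comp_dHat_zero_one, comp_dHat_one_zero, comp_dHat_one_one, comp_neg,
        comp_mkFam_zero_zero, comp_mkFam_zero_one, comp_mkFam_one_zero, comp_mkFam_one_one, comp_sub,
        comp_add]
      linear_combination h

end BasedComplex

/-! ### The group `Q_0(C(u), γ(u))`. -/

namespace BasedComplex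

variable {R : Type u} [CommRing R] {u : R}

/-- The invariant `φ₀ - 2(θ₀₁ + θ₁₀) + 4 u θ₀₁²` of a structure of degree `0`. -/
def zeroInv (s : TwStr (γ₁ u) 0) : R :=
  comp s.φ 0 0 - 2 * (comp s.θ 0 1 + comp s.θ 1 0) + 4 * u * comp s.θ 0 1 ^ 2

theorem TwStr.comp_φ_zero (s : TwStr (γ₁ u) 0) :
    comp s.φ 0 0 - u * comp s.φ 0 0 ^ 2 =
      2 * (comp s.θ 0 0 + comp s.θ 0 1 + comp s.θ 1 0) ∧
    comp s.φ 0 1 = -2 * comp s.θ 1 1 - comp s.θ 0 1 + comp s.θ 1 0 ∧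
    comp s.φ 1 0 = 2 * comp s.θ 1 1 - comp s.θ 1 0 + comp s.θ 0 1 ∧ comp s.φ 1 1 = 0 := by
  have h := fam_ext_iff.1 s.dθ
  rw [hatMap_zero_eq] at h
  simp [comp_dHat_zero_zero, comp_dHat_zero_one, comp_dHat_one_zero, comp_dHat_one_one, comp_sub,
    comp_mkFam_zero_zero, comp_mkFam_zero_one, comp_mkFam_one_zero, comp_mkFam_one_one] at h
  obtain ⟨h1, h2, h3, h4⟩ := h
  refine ⟨?_, ?_, ?_, h4.symm⟩
  · linear_combination -h1
  · linear_combination -h2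
  · linear_combination -h3

theorem zeroInv_mem_num (s : TwStr (γ₁ u) 0) : zeroInv s ∈ Explicit.num u := by
  obtain ⟨h, -⟩ := s.comp_φ_zero
  -- The invariant is `φ₀₀ + 2k`, and `φ₀₀` satisfies the parity condition by the entry at `(0, 0)`
  -- of the structure equation.
  set k := -(comp s.θ 0 1 + comp s.θ 1 0) + 2 * u * comp s.θ 0 1 ^ 2 with hk
  have e : zeroInv s = comp s.φ 0 0 + 2 * k := by rw [zeroInv, hk]; ring
  refine ⟨comp s.θ 0 0 + comp s.θ 0 1 + comp s.θ 1 0 + k - 2 * comp s.φ 0 0 * k * u - 2 * k ^ 2 * u,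
    ?_⟩
  rw [e]
  linear_combination h

/-- The correction term of the sum only meets `θ₀₀`, which `zeroInv` does not use. The defect is the
polarisation `8uθ₀₁θ'₀₁` of the quadratic term. -/
theorem zeroInv_add (s t : TwStr (γ₁ u) 0) : ∃ c, zeroInv (s + t) = zeroInv s + zeroInv t + 8 * c := by
  refine ⟨u * comp s.θ 0 1 * comp t.θ 0 1, ?_⟩
  simp only [zeroInv, TwStr.add_θ, TwStr.add_φ, cross_zero_eq, comp_add, comp_mkFam_zero_one,
    comp_mkFam_one_zero]
  ring

/-- With `x = ξ₀₁`, the linear part of the invariant changes by `4β + 4ux²` mod 8, where `β = uφ₀₀x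
+ η₀₁ + η₁₀`. Mod 2, `θ₀₁` changes by `x - β`, so the quadratic term changes by `4ux² + 4uβ²` mod 8.
The terms in `x²` cancel mod 8, leaving `4β - 4β²u`; this is why the quadratic term is needed. -/
theorem zeroInv_sub_mem {s t : TwStr (γ₁ u) 0} (h : TwStr.Equivalent s t) :
    -zeroInv s + zeroInv t ∈ Explicit.denZero u := by
  obtain ⟨ξ, η, hξ, h1, h2⟩ := h
  have hξ0 : comp ξ 0 0 = 0 := comp_eq_zero_of_mem hξ (by norm_num)
  have h1 := (fam_ext_iff.1 h1).1
  have h2 := fam_ext_iff.1 h2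
  rw [homTerm_zero_eq] at h2
  simp [comp_dHat_zero_zero, comp_sub, hξ0] at h1
  simp [comp_dHat_zero_one, comp_dHat_one_zero, comp_dHat_zero_zero, comp_dHat_one_one, comp_sub,
    comp_add, comp_mkFam_zero_zero, comp_mkFam_zero_one, comp_mkFam_one_zero,
    comp_mkFam_one_one, negOnePow_two] at h2
  obtain ⟨-, h3, h4, -⟩ := h2
  unfold zeroInv
  generalize comp t.φ 0 0 = a' at *
  generalize comp s.φ 0 0 = a at *
  generalize comp t.θ 0 1 = T at *
  generalize comp t.θ 1 0 = T' at *
  generalize comp s.θ 0 1 = S at *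
  generalize comp s.θ 1 0 = S' at *
  generalize comp ξ 0 1 = x at *
  generalize comp ξ 1 0 = y at *
  obtain ⟨h, hh⟩ : ∃ h, h = comp η 0 1 + comp η 1 0 := ⟨_, rfl⟩
  obtain ⟨v, hv⟩ : ∃ v, v = u * x * y + comp η 1 1 := ⟨_, rfl⟩
  obtain ⟨z, hz⟩ : ∃ z, z = u * a * x := ⟨_, rfl⟩
  -- `w - 2v` is the change of `θ₀₁`, and `z + h` is the parameter `β`.
  obtain ⟨w, hw⟩ : ∃ w, w = x - z - h := ⟨_, rfl⟩
  have ea : a' = a + 2 * (x + y) := by linear_combination -h1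
  have eT : T = S + (w - 2 * v) := by rw [hw, hv, hz, hh]; linear_combination -h3
  have eT' : T' = S' + y - u * a' * x + 2 * comp η 1 1 - h := by rw [hh]; linear_combination -h4
  refine ⟨z + h, u * x * y + u * x ^ 2 + u * (z ^ 2 + h ^ 2) - u * x * z - u * x * h +
    2 * u * z * h - 2 * u * w * v + 2 * u * v ^ 2 + u * S * (T - S), ?_⟩
  rw [eT', eT, ea, hv, hw, hz]
  ring

/-- The equations for `ξ` and `η` are solved entry by entry; the parameters `β, c` of the invariant
make the only division, by 4, possible. -/
theorem equivalent_zero_of_zeroInv_mem (hR : (2 : R) ∈ nonZeroDivisors R) (s : TwStr (γ₁ u) 0)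
    (h : zeroInv s ∈ Explicit.denZero u) : TwStr.Equivalent s 0 := by
  obtain ⟨β, c, h⟩ := h
  obtain ⟨h0, h1, h2, h3⟩ := s.comp_φ_zero
  rw [zeroInv] at h
  -- `y` is forced by the entry at `(0, 0)` of `dξ = -φ`. The entry at `(0, 1)` of the equation for
  -- `η` then reads `4e = 2(x + θ₀₁ + β) + 2u(x² - θ₀₁² - β²) + 4c`; this `x` kills the first
  -- bracket and gives `e = c + uθ₀₁β`.
  obtain ⟨x, hx⟩ : ∃ x, x = -comp s.θ 0 1 - β := ⟨_, rfl⟩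
  obtain ⟨y, hy⟩ : ∃ y, y = -(comp s.θ 0 1 + comp s.θ 1 0) + 2 * u * comp s.θ 0 1 ^ 2 - 4 * c -
    2 * β + 2 * β ^ 2 * u - x := ⟨_, rfl⟩
  obtain ⟨e, he⟩ : ∃ e, e = c + u * comp s.θ 0 1 * β := ⟨_, rfl⟩
  have ha : comp s.φ 0 0 = -2 * (x + y) := by rw [hy]; linear_combination h
  -- The remaining equation, at `(0, 0)`. Its double is `h0` after substitution, so 2 has to be
  -- cancelled.
  have key : 2 * (comp s.θ 1 0 + y + 2 * e) = -comp s.θ 0 0 + 2 * u * y * comp s.φ 0 0 +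
      2 * u * y ^ 2 := by
    refine DyadicPoly.two_cancel hR ?_
    rw [ha] at h0 ⊢
    rw [he, hy, hx]
    rw [hy, hx] at h0
    linear_combination -h0
  -- The last entry of `ξ` and the entry `η₀₁` are read off from the equation for `η` at `(1, 1)`
  -- and `(1, 0)`.
  refine ⟨mkFam 0 x y (-comp s.θ 1 1 + u * x ^ 2 - 2 * e),
    mkFam 0 (comp s.θ 1 0 + y + 2 * e) 0 e, mem_symChains ?_, ?_, ?_⟩
  · rintro p q (rfl | rfl) (rfl | rfl) hpq
    · exact comp_mkFam_zero_zero _ _ _ _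
    all_goals norm_num at hpq
  · change _ = 0 - _
    refine fam_ext ?_ ?_ ?_ ?_ <;>
    simp [comp_dHat_zero_zero, comp_dHat_zero_one, comp_dHat_one_zero, comp_dHat_one_one, comp_neg,
        comp_mkFam_zero_zero, comp_mkFam_zero_one, comp_mkFam_one_zero, comp_mkFam_one_one, h1, h2, h3]
    · rw [ha]; ring
    · rw [he, hy, hx]; ring
    · rw [he, hy, hx]; ring
  · rw [homTerm_zero_eq]
    change _ = 0 - _ - _ + _
    have h0' : comp (0 : TwStr (γ₁ u) 0).φ 0 0 = 0 := comp_zero _ _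
    refine fam_ext ?_ ?_ ?_ ?_ <;>
    simp [comp_dHat_zero_zero, comp_dHat_zero_one, comp_dHat_one_zero, comp_dHat_one_one, comp_neg,
        comp_mkFam_zero_zero, comp_mkFam_zero_one, comp_mkFam_one_zero, comp_mkFam_one_one, comp_sub,
        comp_add, negOnePow_two, h0']
    · linear_combination key
    · rw [ha, he, hy, hx]; ring
    · ring
    · ring

theorem exists_equiv_zero (hR : (2 : R) ∈ nonZeroDivisors R) (u : R) :
    ∃ e : TwistedQ (γ₁ u) 0 ≃+ Explicit.QZero u,
      ∀ s, e (TwistedQ.mk s) = QuotientAddGroup.mk ⟨zeroInv s, zeroInv_mem_num s⟩ := by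
  refine exists_equiv_of_twStr_hom (AddMonoidHom.mk' (fun s =>
    (QuotientAddGroup.mk ⟨zeroInv s, zeroInv_mem_num s⟩ : Explicit.QZero u)) ?_) ?_ ?_ ?_
  · intro s t
    rw [← QuotientAddGroup.mk_add, eq_comm, QuotientAddGroup.eq, AddSubgroup.mem_addSubgroupOf]
    obtain ⟨c, hc⟩ := zeroInv_add s t
    change -(zeroInv s + zeroInv t) + zeroInv (s + t) ∈ _
    rw [hc]
    exact ⟨0, c, by ring⟩
  · intro y
    obtain ⟨⟨a, b, hab⟩, rfl⟩ := QuotientAddGroup.mk_surjective y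
    -- In this degree `dθ` has entry `2θ₀₀` at `(0, 0)` when the other entries vanish, and `2b = a -
    -- a²u`.
    refine ⟨⟨mkFam a 0 0 0, mkFam b 0 0 0, ⟨mem_symChains fun p q hp hq h => by omega, ?_⟩, ?_⟩, ?_⟩
    · refine fam_ext ?_ ?_ ?_ ?_ <;>
      simp [comp_dHat_zero_zero, comp_dHat_zero_one, comp_dHat_one_zero, comp_dHat_one_one, comp_zero,
        comp_mkFam_zero_zero, comp_mkFam_zero_one, comp_mkFam_one_zero, comp_mkFam_one_one]
    · rw [hatMap_zero_eq]
      refine fam_ext ?_ ?_ ?_ ?_ <;>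
      simp [comp_dHat_zero_zero, comp_dHat_zero_one, comp_dHat_one_zero, comp_dHat_one_one, comp_sub,
        comp_mkFam_zero_zero, comp_mkFam_zero_one, comp_mkFam_one_zero, comp_mkFam_one_one]
      linear_combination -hab
    · rw [AddMonoidHom.mk'_apply]
      congr 2
      simp [zeroInv, comp_mkFam_zero_zero, comp_mkFam_zero_one, comp_mkFam_one_zero]
  · intro s t h
    rw [AddMonoidHom.mk'_apply, QuotientAddGroup.eq]
    exact zeroInv_sub_mem h
  · intro s hs
    rw [AddMonoidHom.mk'_apply, QuotientAddGroup.eq_zero_iff] at hs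
    exact equivalent_zero_of_zeroInv_mem hR s hs

theorem zeroInv_of_vanish (s : TwStr (γ₁ u) 0) (hθ : ∀ p q, 1 ≤ p + q → s.θ p q = 0) :
    zeroInv s = c00 s.φ := by
  rw [zeroInv, (apply_eq_zero_iff _ _ _).1 (hθ 0 1 le_rfl),
    (apply_eq_zero_iff _ _ _).1 (hθ 1 0 le_rfl), c00_eq]
  ring

end BasedComplex

/-! ### The image of `Q_1(C(u), γ(u))` in `Q^1(C(u))`. -/

namespace BasedComplex

variable {R : Type u} [CommRing R] {u : R}

theorem mkFam_mem_symCycles_one (b : R) : mkFam 0 b (-b) (-b) ∈ symCycles (C₁ R) 1 := by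
  refine ⟨mem_symChains ?_, ?_⟩
  · rintro p q (rfl | rfl) (rfl | rfl) hpq
    · exact comp_mkFam_zero_zero _ _ _ _
    all_goals norm_num at hpq
  · refine fam_ext ?_ ?_ ?_ ?_ <;>
    simp [comp_dHat_zero_zero, comp_dHat_zero_one, comp_dHat_one_zero, comp_dHat_one_one, comp_zero,
      comp_mkFam_zero_zero, comp_mkFam_zero_one, comp_mkFam_one_zero, comp_mkFam_one_one] <;>
    ring

/-- The entry at `(0, 0)` lies outside the symmetric range; the cycle equations give twice the
relations `φ₁₀ = φ₁₁ = -φ₀₁`. -/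
theorem eq_mkFam_of_mem_symCycles_one (hR : (2 : R) ∈ nonZeroDivisors R) {φ : Fam (C₁ R) (C₁ R)}
    (h : φ ∈ symCycles (C₁ R) 1) : φ = mkFam 0 (c01 φ) (-c01 φ) (-c01 φ) := by
  have h0 : comp φ 0 0 = 0 := comp_eq_zero_of_mem h.1 (by norm_num)
  obtain ⟨h1, h2, -, -⟩ := fam_ext_iff.1 (show dHat _ 1 φ = 0 from h.2)
  simp [comp_dHat_zero_zero, comp_dHat_zero_one, comp_zero, h0] at h1 h2
  have h10 : comp φ 1 0 = -comp φ 0 1 :=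
    DyadicPoly.two_cancel hR (by linear_combination h1)
  have h11 : comp φ 1 1 = -comp φ 0 1 :=
    DyadicPoly.two_cancel hR (by linear_combination -h2 + h10)
  refine fam_ext ?_ ?_ ?_ ?_ <;>
  simp [comp_mkFam_zero_zero, comp_mkFam_zero_one, comp_mkFam_one_zero, comp_mkFam_one_one, c01_eq,
    h0, h10, h11]

/-- At `(1, 1)` the structure equation says `2θ₁₁ = -b - ub²` with `b = φ₀₁`, which has the parity
of `b - b²u`. -/
theorem c01_mem_num (hR : (2 : R) ∈ nonZeroDivisors R) (s : TwStr (γ₁ u) 1) :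
    c01 s.φ ∈ Explicit.num u := by
  have h := (fam_ext_iff.1 s.dθ).2.2.2
  rw [hatMap_one_eq] at h
  have h' := eq_mkFam_of_mem_symCycles_one hR s.φ_mem
  have h11 : comp s.φ 1 1 = -comp s.φ 0 1 := by
    rw [h', comp_mkFam_one_one, comp_mkFam_zero_one]
  simp [comp_dHat_one_one, comp_sub, comp_mkFam_one_one, negOnePow_two, h11] at h
  refine ⟨-comp s.θ 1 1 - u * comp s.φ 0 1 ^ 2, ?_⟩
  rw [c01_eq]
  linear_combination h

/-- The class in `Q^1(C)` of the structure with component `C^0 → C_1` equal to `b`. -/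
def symClass (R : Type u) [CommRing R] : R →+ SymQ (C₁ R) 1 :=
  (QuotientAddGroup.mk' _).comp (AddMonoidHom.mk'
    (fun b => (⟨mkFam 0 b (-b) (-b), mkFam_mem_symCycles_one b⟩ : symCycles (C₁ R) 1)) (by
      intro b c
      refine Subtype.ext ?_
      change _ = mkFam 0 b (-b) (-b) + mkFam 0 c (-c) (-c)
      refine fam_ext ?_ ?_ ?_ ?_ <;>
      simp [comp_add, comp_mkFam_zero_zero, comp_mkFam_zero_one, comp_mkFam_one_zero,
        comp_mkFam_one_one, add_comm]))

/-- A symmetric chain of degree 2 has only the entry at `(1, 1)`, whose boundary has entry `-2ξ₁₁`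
at `(0, 1)`. -/
theorem symClass_eq_zero_iff (b : R) : symClass R b = 0 ↔ ∃ c, b = 2 * c := by
  refine (QuotientAddGroup.eq_zero_iff _).trans ?_
  rw [AddSubgroup.mem_addSubgroupOf]
  constructor
  · rintro ⟨ξ, hξ, h⟩
    have h01 : comp ξ 0 1 = 0 := comp_eq_zero_of_mem hξ (by norm_num)
    have h10 : comp ξ 1 0 = 0 := comp_eq_zero_of_mem hξ (by norm_num)
    have h2 := (fam_ext_iff.1 h).2.1
    change _ = comp (mkFam 0 b (-b) (-b)) 0 1 at h2
    simp [comp_dHat_zero_one, comp_mkFam_zero_one, h01, h10] at h2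
    exact ⟨-comp ξ 1 1, by linear_combination -h2⟩
  · rintro ⟨c, rfl⟩
    refine ⟨mkFam 0 0 0 (-c), mem_symChains ?_, ?_⟩
    · rintro p q (rfl | rfl) (rfl | rfl) hpq
      · exact comp_mkFam_zero_zero _ _ _ _
      · exact comp_mkFam_zero_one _ _ _ _
      · exact comp_mkFam_one_zero _ _ _ _
      · norm_num at hpq
    · change _ = mkFam _ _ _ _
      refine fam_ext ?_ ?_ ?_ ?_ <;>
      simp [comp_dHat_zero_zero, comp_dHat_zero_one, comp_dHat_one_zero, comp_dHat_one_one,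
        comp_mkFam_zero_zero, comp_mkFam_zero_one, comp_mkFam_one_zero, comp_mkFam_one_one,
        negOnePow_two]
      ring

theorem symPart_mk_eq (hR : (2 : R) ∈ nonZeroDivisors R) (s : TwStr (γ₁ u) 1) :
    symPart _ 1 (TwistedQ.mk s) = symClass R (c01 s.φ) :=
  congrArg (QuotientAddGroup.mk' _) (Subtype.ext (eq_mkFam_of_mem_symCycles_one hR s.φ_mem))

theorem symClass_mem_range (hR : (2 : R) ∈ nonZeroDivisors R) {b : R} (hb : b ∈ Explicit.num u) :
    symClass R b ∈ (symPart (γ₁ u) 1).range := by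
  obtain ⟨c, hc⟩ := hb
  -- The entry `ub²` balances the term `-2ub²` of the bundle at `(0, 0)`; the last entry is half of
  -- `-b - ub²`, since `b - b²u = 2c`.
  refine ⟨TwistedQ.mk ⟨mkFam 0 b (-b) (-b), mkFam 0 (u * b ^ 2) 0 (-c - u * b ^ 2),
    mkFam_mem_symCycles_one b, ?_⟩, ?_⟩
  · rw [hatMap_one_eq]
    refine fam_ext ?_ ?_ ?_ ?_ <;>
    simp [comp_dHat_zero_zero, comp_dHat_zero_one, comp_dHat_one_zero, comp_dHat_one_one, comp_sub,
      comp_mkFam_zero_zero, comp_mkFam_zero_one, comp_mkFam_one_zero, comp_mkFam_one_one,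
      negOnePow_two]
    · ring
    · linear_combination -hc
    · linear_combination hc
    · linear_combination hc
  · rw [symPart_mk_eq hR, c01_eq, comp_mkFam_zero_one]

theorem exists_equiv_one (hR : (2 : R) ∈ nonZeroDivisors R) (u : R) :
    ∃ e : (symPart (γ₁ u) 1).range ≃+ Explicit.QOne u, ∀ s,
      e ⟨symPart _ 1 (TwistedQ.mk s), ⟨_, rfl⟩⟩ =
        QuotientAddGroup.mk ⟨c01 s.φ, c01_mem_num hR s⟩ := by
  obtain ⟨e, he⟩ : ∃ e : Explicit.QOne u ≃+ (symPart (γ₁ u) 1).range,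
      ∀ b, e (QuotientAddGroup.mk b) = ⟨symClass R b.1, symClass_mem_range hR b.2⟩ := by
    refine DyadicPoly.exists_equiv_of_hom _
      (((symClass R).comp (Explicit.num u).subtype).codRestrict _
        fun b => symClass_mem_range hR b.2) ?_ ?_
    · rintro ⟨_, x, rfl⟩
      induction x using AddCon.induction_on with
      | H s => exact ⟨⟨c01 s.φ, c01_mem_num hR s⟩, Subtype.ext (symPart_mk_eq hR s).symm⟩
    · intro b
      rw [AddSubgroup.mem_addSubgroupOf, Subtype.ext_iff]
      refine Iff.trans ?_ (symClass_eq_zero_iff b.1).symm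
      exact ⟨fun ⟨c, hc⟩ => ⟨c, hc.symm⟩, fun ⟨c, hc⟩ => ⟨c, hc.symm⟩⟩
  refine ⟨e.symm, fun s => ?_⟩
  rw [AddEquiv.symm_apply_eq, he]
  exact Subtype.ext (symPart_mk_eq hR s)

/-! ### The homology groups `H_1` and `H_0` of the tensor product. -/

section Tensor

theorem comp_dV_zero_zero (f : Fam (C₁ R) (C₁ R)) :
    comp (dV _ _ f) 0 0 = 2 * (comp f 0 1 + comp f 1 0) := by
  simp [comp_dV]; ring

theorem comp_dV_zero_one (f : Fam (C₁ R) (C₁ R)) :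
    comp (dV _ _ f) 0 1 = -(2 * comp f 1 1) := by
  simp [comp_dV]

theorem comp_dV_one_zero (f : Fam (C₁ R) (C₁ R)) :
    comp (dV _ _ f) 1 0 = 2 * comp f 1 1 := by
  simp [comp_dV]

theorem comp_dV_one_one (f : Fam (C₁ R) (C₁ R)) : comp (dV _ _ f) 1 1 = 0 := by
  simp [comp_dV]

theorem mem_tensorChains {n : ℤ} {f : Fam (C₁ R) (C₁ R)}
    (h : ∀ p q, (p = 0 ∨ p = 1) → (q = 0 ∨ q = 1) → p + q ≠ n → comp f p q = 0) :
    f ∈ tensorChains (C₁ R) (C₁ R) n := by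
  intro p q hpq
  rw [apply_eq_zero_iff]
  by_cases h' : (p = 0 ∨ p = 1) ∧ (q = 0 ∨ q = 1)
  · exact h p q h'.1 h'.2 hpq
  · exact comp_of_ne _ h'

theorem comp_eq_zero_of_mem_tensorChains {n : ℤ} {f : Fam (C₁ R) (C₁ R)}
    (h : f ∈ tensorChains (C₁ R) (C₁ R) n) {p q : ℤ} (hpq : p + q ≠ n) : comp f p q = 0 :=
  (apply_eq_zero_iff _ _ _).1 (h p q hpq)

/-- The cycle equation is twice this relation; it makes the component `C^0 → C_1` a full coordinate
on 1-cycles. -/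
theorem comp_one_zero_of_mem (hR : (2 : R) ∈ nonZeroDivisors R) {f : Fam (C₁ R) (C₁ R)}
    (h : f ∈ tensorCycles (C₁ R) (C₁ R) 1) : comp f 1 0 = -comp f 0 1 := by
  have h1 := (fam_ext_iff.1 (show dV _ _ f = 0 from h.2)).1
  rw [comp_dV_zero_zero, comp_zero] at h1
  exact DyadicPoly.two_cancel hR (by linear_combination h1)

theorem mem_tensorBoundaries_one_iff (hR : (2 : R) ∈ nonZeroDivisors R) {f : Fam (C₁ R) (C₁ R)}
    (h : f ∈ tensorCycles (C₁ R) (C₁ R) 1) :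
    f ∈ tensorBoundaries (C₁ R) (C₁ R) 1 ↔ ∃ c, c01 f = 2 * c := by
  rw [c01_eq]
  constructor
  · rintro ⟨x, -, rfl⟩
    exact ⟨-comp x 1 1, by rw [comp_dV_zero_one]; ring⟩
  · rintro ⟨c, hc⟩
    refine ⟨mkFam 0 0 0 (-c), mem_tensorChains ?_, ?_⟩
    · rintro p q (rfl | rfl) (rfl | rfl) hpq
      · exact comp_mkFam_zero_zero _ _ _ _
      · exact comp_mkFam_zero_one _ _ _ _
      · exact comp_mkFam_one_zero _ _ _ _
      · norm_num at hpq
    · refine fam_ext ?_ ?_ ?_ ?_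
      · rw [comp_dV_zero_zero, comp_eq_zero_of_mem_tensorChains h.1 (by norm_num),
          comp_mkFam_zero_one, comp_mkFam_one_zero, add_zero, mul_zero]
      · rw [comp_dV_zero_one, comp_mkFam_one_one, hc]; ring
      · rw [comp_dV_one_zero, comp_mkFam_one_one, comp_one_zero_of_mem hR h, hc]; ring
      · rw [comp_dV_one_one, comp_eq_zero_of_mem_tensorChains h.1 (by norm_num)]

theorem mem_tensorBoundaries_zero_iff {f : Fam (C₁ R) (C₁ R)}
    (h : f ∈ tensorCycles (C₁ R) (C₁ R) 0) :
    f ∈ tensorBoundaries (C₁ R) (C₁ R) 0 ↔ ∃ c, c00 f = 2 * c := by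
  rw [c00_eq]
  constructor
  · rintro ⟨x, -, rfl⟩
    exact ⟨_, comp_dV_zero_zero x⟩
  · rintro ⟨c, hc⟩
    refine ⟨mkFam 0 c 0 0, mem_tensorChains ?_, ?_⟩
    · rintro p q (rfl | rfl) (rfl | rfl) hpq
      · exact comp_mkFam_zero_zero _ _ _ _
      · norm_num at hpq
      · exact comp_mkFam_one_zero _ _ _ _
      · exact comp_mkFam_one_one _ _ _ _
    · refine fam_ext ?_ ?_ ?_ ?_
      · rw [comp_dV_zero_zero, comp_mkFam_zero_one, comp_mkFam_one_zero, hc, add_zero]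
      · rw [comp_dV_zero_one, comp_mkFam_one_one,
          comp_eq_zero_of_mem_tensorChains h.1 (by norm_num)]; ring
      · rw [comp_dV_one_zero, comp_mkFam_one_one,
          comp_eq_zero_of_mem_tensorChains h.1 (by norm_num)]; ring
      · rw [comp_dV_one_one, comp_eq_zero_of_mem_tensorChains h.1 (by norm_num)]

theorem mkFam_mem_tensorCycles_one (b : R) :
    mkFam 0 b (-b) 0 ∈ tensorCycles (C₁ R) (C₁ R) 1 := by
  refine ⟨mem_tensorChains ?_, ?_⟩
  · rintro p q (rfl | rfl) (rfl | rfl) hpq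
    · exact comp_mkFam_zero_zero _ _ _ _
    · norm_num at hpq
    · norm_num at hpq
    · exact comp_mkFam_one_one _ _ _ _
  · refine fam_ext ?_ ?_ ?_ ?_ <;>
    simp [comp_dV_zero_zero, comp_dV_zero_one, comp_dV_one_zero, comp_dV_one_one, comp_zero,
      comp_mkFam_zero_one, comp_mkFam_one_zero, comp_mkFam_one_one]

theorem mkFam_mem_tensorCycles_zero (b : R) :
    mkFam b 0 0 0 ∈ tensorCycles (C₁ R) (C₁ R) 0 := by
  refine ⟨mem_tensorChains ?_, ?_⟩
  · rintro p q (rfl | rfl) (rfl | rfl) hpq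
    · norm_num at hpq
    · exact comp_mkFam_zero_one _ _ _ _
    · exact comp_mkFam_one_zero _ _ _ _
    · exact comp_mkFam_one_one _ _ _ _
  · refine fam_ext ?_ ?_ ?_ ?_ <;>
    simp [comp_dV_zero_zero, comp_dV_zero_one, comp_dV_one_zero, comp_dV_one_one, comp_zero,
      comp_mkFam_zero_one, comp_mkFam_one_zero, comp_mkFam_one_one]

theorem exists_tensorH_one {A : Type u} [CommRing A] (hA : IsOneEven A) :
    ∃ l : TensorH (C₁ A[X]) (C₁ A[X]) 1 ≃+ (ModBy A 2)[X],
      ∀ h, l (QuotientAddGroup.mk h) = red 2 (c01 h.1) := by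
  refine DyadicPoly.exists_equiv_of_hom _ (AddMonoidHom.mk'
    (fun h : tensorCycles (C₁ A[X]) (C₁ A[X]) 1 => red 2 (c01 h.1))
    (fun f g => by rw [← Polynomial.map_add]; rfl)) ?_ ?_
  · intro y
    obtain ⟨y, rfl⟩ := DyadicPoly.red_surjective 2 y
    refine ⟨⟨_, mkFam_mem_tensorCycles_one y⟩, ?_⟩
    rw [AddMonoidHom.mk'_apply, c01_eq, comp_mkFam_zero_one]
  · intro f
    rw [AddSubgroup.mem_addSubgroupOf,
      mem_tensorBoundaries_one_iff (DyadicPoly.two_mem_nonZeroDivisors hA) f.2]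
    exact (DyadicPoly.red_eq_zero 2 _).symm

theorem exists_tensorH_zero (A : Type u) [CommRing A] :
    ∃ l : TensorH (C₁ A[X]) (C₁ A[X]) 0 ≃+ (ModBy A 2)[X],
      ∀ h, l (QuotientAddGroup.mk h) = red 2 (c00 h.1) := by
  refine DyadicPoly.exists_equiv_of_hom _ (AddMonoidHom.mk'
    (fun h : tensorCycles (C₁ A[X]) (C₁ A[X]) 0 => red 2 (c00 h.1))
    (fun f g => by rw [← Polynomial.map_add]; rfl)) ?_ ?_
  · intro y
    obtain ⟨y, rfl⟩ := DyadicPoly.red_surjective 2 y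
    refine ⟨⟨_, mkFam_mem_tensorCycles_zero y⟩, ?_⟩
    rw [AddMonoidHom.mk'_apply, c00_eq, comp_mkFam_zero_zero]
  · intro f
    rw [AddSubgroup.mem_addSubgroupOf, mem_tensorBoundaries_zero_iff f.2]
    exact (DyadicPoly.red_eq_zero 2 _).symm

end Tensor

/-! ### The connecting maps in coordinates. -/

theorem exists_connecting_eq {D C : BasedComplex R} (δ : ChainBundle D) (γ : ChainBundle C)
    {m n : ℤ} (h : m = n + 1) (f : tensorCycles D C m) : ∃ s : TwStr γ n,
      connecting δ γ h (QuotientAddGroup.mk f) = TwistedQ.mk s ∧ s.φ = 0 ∧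
        s.θ = hatMap δ m f.1 :=
  ⟨_, rfl, rfl, rfl⟩

/-- The image structure has `φ = 0` and `θ₁₀ = -2vf₁₀f₀₁ = 2vf₀₁²`, and `zeroInv` multiplies this by
`-2`. -/
theorem connecting_zero_eq (hR : (2 : R) ∈ nonZeroDivisors R) {u v : R}
    {e : TwistedQ (γ₁ u) 0 ≃+ Explicit.QZero u}
    (he : ∀ s, e (TwistedQ.mk s) = QuotientAddGroup.mk ⟨zeroInv s, zeroInv_mem_num s⟩)
    (f : tensorCycles (C₁ R) (C₁ R) 1) : ∃ h,
      e (connecting (γ₁ v) (γ₁ u) (m := 1) (n := 0) (by norm_num) (QuotientAddGroup.mk f)) =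
        QuotientAddGroup.mk ⟨-4 * v * c01 f.1 ^ 2, h⟩ := by
  obtain ⟨s, h1, h2, h3⟩ := exists_connecting_eq (γ₁ v) (γ₁ u) (m := 1) (n := 0) (by norm_num) f
  have h : zeroInv s = -4 * v * c01 f.1 ^ 2 := by
    rw [zeroInv, h2, h3, hatMap_one_eq, comp_zero, comp_mkFam_zero_one, comp_mkFam_one_zero,
      comp_one_zero_of_mem hR f.2, c01_eq]
    ring
  rw [h1, he]
  exact ⟨h ▸ zeroInv_mem_num s, congrArg _ (Subtype.ext h)⟩

theorem connecting_neg_one_eq {u v : R} {e : TwistedQ (γ₁ u) (-1) ≃+ Explicit.QNeg u}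
    (he : ∀ s, e (TwistedQ.mk s) = QuotientAddGroup.mk (c00 s.θ))
    (f : tensorCycles (C₁ R) (C₁ R) 0) :
    e (connecting (γ₁ v) (γ₁ u) (m := 0) (n := -1) (by norm_num) (QuotientAddGroup.mk f)) =
      QuotientAddGroup.mk (v * c00 f.1 ^ 2) := by
  obtain ⟨s, h1, -, h3⟩ := exists_connecting_eq (γ₁ v) (γ₁ u) (m := 0) (n := -1) (by norm_num) f
  rw [h1, he, h3, hatMap_zero_eq, c00_eq, comp_mkFam_zero_zero, c00_eq]

/-- Transposition exchanges the mixed components without a sign; the minus sign is the cycle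
relation, and disappears once the component is squared. -/
theorem exists_tensorSwap_one_eq (hR : (2 : R) ∈ nonZeroDivisors R)
    (f : tensorCycles (C₁ R) (C₁ R) 1) : ∃ g : tensorCycles (C₁ R) (C₁ R) 1,
      tensorSwap 1 (QuotientAddGroup.mk f) = QuotientAddGroup.mk g ∧ c01 g.1 = -c01 f.1 := by
  refine ⟨⟨_, transp_mem_cycles f.2⟩, rfl, ?_⟩
  rw [c01_eq, comp_transp, c01_eq, comp_one_zero_of_mem hR f.2]
  simp

theorem exists_tensorSwap_zero_eq (f : tensorCycles (C₁ R) (C₁ R) 0) :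
    ∃ g : tensorCycles (C₁ R) (C₁ R) 0,
      tensorSwap 0 (QuotientAddGroup.mk f) = QuotientAddGroup.mk g ∧ c00 g.1 = c00 f.1 := by
  refine ⟨⟨_, transp_mem_cycles f.2⟩, rfl, ?_⟩
  rw [c00_eq, comp_transp, c00_eq]
  simp

end BasedComplex

/-! ### Coefficient formulas and assembly. -/

namespace DyadicPoly

variable {A : Type u} [CommRing A]

theorem cls_zero (k : ℕ) : cls k (0 : A) = 0 := map_zero _

theorem red_foldOdd_divX_coeff (a : A[X]) (i : ℕ) :
    (red 2 (foldOdd (divX a))).coeff i = cls 2 (dyadicSum a.coeff i) := by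
  rw [coeff_map, coeff_foldOdd]
  refine congrArg _ (finsum_congr fun j => ?_)
  -- Dividing by `X` shifts indices by one, which cancels the `k - 1` in `coeff_foldOdd`.
  have : 0 < (2 * i + 1) * 2 ^ j := by positivity
  change (divX a).coeff (_ - 1) = _
  rw [coeff_divX, Nat.sub_add_cancel this]

/-- Multiplication by 2 is well defined from `A_2[x]` to `A_4[x]`, so any lift `c` may be used. -/
theorem red_eq_of_red_two_eq {a c : A[X]} (h : red 2 a = red 2 c) :
    red 4 (2 * a) = red 4 (2 * c) := by
  rw [← sub_eq_zero, ← Polynomial.map_sub, red_eq_zero] at h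
  obtain ⟨d, hd⟩ := h
  refine red_eq_red 4 d ?_
  push_cast at hd ⊢
  linear_combination 2 * hd

theorem red_neg_two_mul (a : A[X]) : red 4 (2 * -a) = red 4 (2 * a) :=
  red_eq_red 4 (-a) (by push_cast; ring)

/-- The coefficients of an element of `num 1` in positive degrees are even. -/
theorem exists_eq_C_add_two_mul (hA : IsOneEven A) {a : A[X]} (ha : a ∈ Explicit.num (1 : A[X])) :
    ∃ b, a = C (a.coeff 0) + X * (2 * b) := by
  obtain ⟨b, hb⟩ := (mem_num_X_iff hA _).1 (divX_mem_num hA ha)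
  exact ⟨b, by rw [← hb, add_comm, X_mul_divX_add]⟩

end DyadicPoly

open DyadicPoly

theorem mainTheorem8 {A : Type u} [CommRing A] (hA : IsOneEven A) :
    -- the identifications of `H_n(C(1) ⊗ C(x))` with `A₂[x]`, for `n = 1, 0`
    ∃ (l₁ : BasedComplex.TensorH (BasedComplex.C₁ A[X]) (BasedComplex.C₁ A[X]) 1
          ≃+ (ModBy A 2)[X])
      (l₀ : BasedComplex.TensorH (BasedComplex.C₁ A[X]) (BasedComplex.C₁ A[X]) 0
          ≃+ (ModBy A 2)[X]),
    (∀ h, l₁ (QuotientAddGroup.mk h) = red 2 (BasedComplex.c01 h.1)) ∧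
    (∀ h, l₀ (QuotientAddGroup.mk h) = red 2 (BasedComplex.c00 h.1)) ∧
    -- part (i): `u = 1`
    (∃ (κm : BasedComplex.TwistedQ (BasedComplex.γ₁ (1 : A[X])) (-1)
            ≃+ Explicit.QNeg (1 : A[X]))
        (κ₀ : BasedComplex.TwistedQ (BasedComplex.γ₁ (1 : A[X])) 0
            ≃+ Explicit.QZero (1 : A[X]))
        (κ₁ : (BasedComplex.symPart (BasedComplex.γ₁ (1 : A[X])) 1).range
            ≃+ Explicit.QOne (1 : A[X]))
        (fm : Explicit.QNeg (1 : A[X]) ≃+ (ModBy A 2)[X])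
        (f₀ : Explicit.QZero (1 : A[X])
            ≃+ ModBy A 8 × (ModBy A 4)[X] × (ModBy A 2)[X])
        (f₁ : Explicit.QOne (1 : A[X]) ≃+ ModBy A 2),
      (∀ s, κm (BasedComplex.TwistedQ.mk s) = QuotientAddGroup.mk (BasedComplex.c00 s.θ)) ∧
      (∀ s, (∀ p q, 1 ≤ p + q → s.φ p q = 0) → (∀ p q, 1 ≤ p + q → s.θ p q = 0) →
        ∃ h, κ₀ (BasedComplex.TwistedQ.mk s) = QuotientAddGroup.mk ⟨BasedComplex.c00 s.φ, h⟩) ∧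
      (∀ s, ∃ h, κ₁ ⟨BasedComplex.symPart _ 1 (BasedComplex.TwistedQ.mk s), ⟨_, rfl⟩⟩ =
        QuotientAddGroup.mk ⟨BasedComplex.c01 s.φ, h⟩) ∧
      (∀ a : A[X], (fm (QuotientAddGroup.mk a)).coeff 0 = cls 2 (a.coeff 0) ∧
        ∀ i, (fm (QuotientAddGroup.mk a)).coeff (i + 1) = cls 2 (dyadicSum a.coeff i)) ∧
      (∀ a, ∃ b : ℕ → A, (∀ k, 1 ≤ k → a.1.coeff k = 2 * b k) ∧
        (f₀ (QuotientAddGroup.mk a)).1 = cls 8 (a.1.coeff 0) ∧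
        (∀ i, (f₀ (QuotientAddGroup.mk a)).2.1.coeff i = cls 4 (dyadicSum b i)) ∧
        (∀ k, (f₀ (QuotientAddGroup.mk a)).2.2.coeff k = cls 2 (b (2 * k + 2)))) ∧
      (∀ a, f₁ (QuotientAddGroup.mk a) = cls 2 (a.1.coeff 0)) ∧
      (∀ h (c : A[X]), l₁ h = red 2 c →
        f₀ (κ₀ (BasedComplex.connecting (BasedComplex.γ₁ X) (BasedComplex.γ₁ 1)
          (m := 1) (n := 0) (by norm_num) (BasedComplex.tensorSwap 1 h))) =
            (0, red 4 (2 * c), 0)) ∧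
      (∀ h, fm (κm (BasedComplex.connecting (BasedComplex.γ₁ X) (BasedComplex.γ₁ 1)
          (m := 0) (n := -1) (by norm_num) (BasedComplex.tensorSwap 0 h))) =
            l₀ h * X)) ∧
    -- part (ii): `u = x`
    (∃ (κm : BasedComplex.TwistedQ (BasedComplex.γ₁ (X : A[X])) (-1)
            ≃+ Explicit.QNeg (X : A[X]))
        (κ₀ : BasedComplex.TwistedQ (BasedComplex.γ₁ (X : A[X])) 0
            ≃+ Explicit.QZero (X : A[X]))
        (κ₁ : (BasedComplex.symPart (BasedComplex.γ₁ (X : A[X])) 1).range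
            ≃+ Explicit.QOne (X : A[X]))
        (fm : Explicit.QNeg (X : A[X]) ≃+ (ModBy A 2)[X])
        (f₀ : Explicit.QZero (X : A[X])
            ≃+ (ModBy A 4)[X] × (ModBy A 2)[X]),
      (∀ s, κm (BasedComplex.TwistedQ.mk s) = QuotientAddGroup.mk (BasedComplex.c00 s.θ)) ∧
      (∀ s, (∀ p q, 1 ≤ p + q → s.φ p q = 0) → (∀ p q, 1 ≤ p + q → s.θ p q = 0) →
        ∃ h, κ₀ (BasedComplex.TwistedQ.mk s) = QuotientAddGroup.mk ⟨BasedComplex.c00 s.φ, h⟩) ∧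
      (∀ s, ∃ h, κ₁ ⟨BasedComplex.symPart _ 1 (BasedComplex.TwistedQ.mk s), ⟨_, rfl⟩⟩ =
        QuotientAddGroup.mk ⟨BasedComplex.c01 s.φ, h⟩) ∧
      (∀ (a : A[X]) (i : ℕ), (fm (QuotientAddGroup.mk a)).coeff i =
        cls 2 (dyadicSum (fun k => a.coeff (k - 1)) i)) ∧
      (∀ a, ∃ b : ℕ → A, (∀ k, a.1.coeff k = 2 * b k) ∧
        (∀ i, (f₀ (QuotientAddGroup.mk a)).1.coeff i =
          cls 4 (dyadicSum (fun k => b (k - 1)) i)) ∧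
        (∀ k, (f₀ (QuotientAddGroup.mk a)).2.coeff k = cls 2 (b (2 * k + 1)))) ∧
      Subsingleton (Explicit.QOne (X : A[X])) ∧
      (∀ h (c : A[X]), l₁ h = red 2 c →
        f₀ (κ₀ (BasedComplex.connecting (BasedComplex.γ₁ 1) (BasedComplex.γ₁ X)
          (m := 1) (n := 0) (by norm_num) h)) = (red 4 (2 * c), 0)) ∧
      (∀ h, fm (κm (BasedComplex.connecting (BasedComplex.γ₁ 1) (BasedComplex.γ₁ X)
          (m := 0) (n := -1) (by norm_num) h)) = l₀ h)) := by
  have hR := two_mem_nonZeroDivisors hA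
  obtain ⟨l₁, hl₁⟩ := BasedComplex.exists_tensorH_one hA
  obtain ⟨l₀, hl₀⟩ := BasedComplex.exists_tensorH_zero A
  refine ⟨l₁, l₀, hl₁, hl₀, ?_, ?_⟩
  · obtain ⟨κm, hκm⟩ := BasedComplex.exists_equiv_neg_one (1 : A[X])
    obtain ⟨κ₀, hκ₀⟩ := BasedComplex.exists_equiv_zero hR (1 : A[X])
    obtain ⟨κ₁, hκ₁⟩ := BasedComplex.exists_equiv_one hR (1 : A[X])
    obtain ⟨fm, hfm⟩ := exists_QNeg_one hA
    obtain ⟨f₀, hf₀⟩ := exists_QZero_one hA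
    obtain ⟨f₁, hf₁⟩ := exists_QOne_one hA
    refine ⟨κm, κ₀, κ₁, fm, f₀, f₁, hκm, ?_, fun s => ⟨_, hκ₁ s⟩, ?_, ?_, hf₁, ?_, ?_⟩
    · intro s _ hθ
      refine ⟨BasedComplex.zeroInv_of_vanish s hθ ▸ BasedComplex.zeroInv_mem_num s, ?_⟩
      rw [hκ₀]
      exact congrArg _ (Subtype.ext (BasedComplex.zeroInv_of_vanish s hθ))
    · intro a
      have h := hfm (a.coeff 0) (divX a)
      rw [add_comm (C _), X_mul_divX_add] at h
      rw [h]
      refine ⟨coeff_zero_C_add _ _, fun i => ?_⟩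
      rw [← red_foldOdd_divX_coeff, ← coeff_divX, divX_C_add]
    · intro a
      obtain ⟨b, hb⟩ := exists_eq_C_add_two_mul hA a.2
      have hdiv : divX a.1 = 2 * b := by rw [hb, divX_C_add]
      -- The halves of the `a_k` are the coefficients of `b` shifted by one; the value of `b.coeff
      -- (k - 1)` at `k = 0` is never used.
      have hc : ∀ k, a.1.coeff (k + 1) = 2 * b.coeff k := by
        intro k
        rw [← coeff_divX, hdiv, coeff_ofNat_mul]
      rw [hf₀ a _ b hb]
      refine ⟨fun k => b.coeff (k - 1), ?_, rfl, fun i => ?_, fun k => ?_⟩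
      · rintro (_ | k) hk
        · omega
        · exact hc k
      · rw [← coeff_foldOdd]
        exact coeff_map _ _
      · refine (coeff_map _ _).trans (congrArg _ ?_)
        exact coeff_oddPart _ _
    · intro h c hc
      obtain ⟨f, rfl⟩ := QuotientAddGroup.mk_surjective h
      obtain ⟨g, hg, hgf⟩ := BasedComplex.exists_tensorSwap_one_eq hR f
      obtain ⟨hmem, h⟩ := BasedComplex.connecting_zero_eq hR (v := X) hκ₀ g
      rw [hl₁] at hc
      -- The class is that of `-4Xc²`, with zero constant term and `X * (2b)` for `b = -2c²`.
      rw [hg, h, hf₀ _ 0 (-(2 * BasedComplex.c01 g.1 ^ 2)) (by rw [map_zero]; ring),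
        foldPair_neg_two_mul_sq hA, hgf, red_neg_two_mul, red_eq_of_red_two_eq hc, cls_zero]
    · intro h
      obtain ⟨f, rfl⟩ := QuotientAddGroup.mk_surjective h
      obtain ⟨g, hg, hgf⟩ := BasedComplex.exists_tensorSwap_zero_eq f
      -- The class is that of `Xc²`: constant term zero, and `c²` folds to `c` mod 2, leaving the
      -- factor `X`.
      have hfm' := hfm 0 (BasedComplex.c00 f.1 ^ 2)
      rw [map_zero, zero_add, cls_zero, map_zero, zero_add, red_foldOdd_sq hA] at hfm'
      rw [hg, BasedComplex.connecting_neg_one_eq hκm, hgf, hfm', hl₀, mul_comm]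
  · obtain ⟨κm, hκm⟩ := BasedComplex.exists_equiv_neg_one (X : A[X])
    obtain ⟨κ₀, hκ₀⟩ := BasedComplex.exists_equiv_zero hR (X : A[X])
    obtain ⟨κ₁, hκ₁⟩ := BasedComplex.exists_equiv_one hR (X : A[X])
    obtain ⟨fm, hfm⟩ := exists_QNeg_X hA
    obtain ⟨f₀, hf₀⟩ := exists_QZero_X hA
    refine ⟨κm, κ₀, κ₁, fm, f₀, hκm, ?_, fun s => ⟨_, hκ₁ s⟩, ?_, ?_, subsingleton_QOne_X hA, ?_, ?_⟩
    · intro s _ hθ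
      refine ⟨BasedComplex.zeroInv_of_vanish s hθ ▸ BasedComplex.zeroInv_mem_num s, ?_⟩
      rw [hκ₀]
      exact congrArg _ (Subtype.ext (BasedComplex.zeroInv_of_vanish s hθ))
    · intro a i
      rw [hfm, coeff_map, coeff_foldOdd]
    · intro a
      obtain ⟨b, hb⟩ := (mem_num_X_iff hA _).1 a.2
      rw [hf₀ a b hb]
      refine ⟨b.coeff, fun k => ?_, fun i => ?_, fun k => ?_⟩
      · rw [hb, coeff_ofNat_mul]
      · rw [← coeff_foldOdd]
        exact coeff_map _ _
      · exact (coeff_map _ _).trans (congrArg _ (coeff_oddPart _ _))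
    · intro h c hc
      obtain ⟨f, rfl⟩ := QuotientAddGroup.mk_surjective h
      obtain ⟨hmem, h⟩ := BasedComplex.connecting_zero_eq hR (v := 1) hκ₀ f
      rw [hl₁] at hc
      -- With `v = 1` the class is that of `-4c²`, whose half is `-2c²`.
      rw [h, hf₀ _ (-(2 * BasedComplex.c01 f.1 ^ 2)) (by ring), foldPair_neg_two_mul_sq hA,
        red_eq_of_red_two_eq hc]
    · intro h
      obtain ⟨f, rfl⟩ := QuotientAddGroup.mk_surjective h
      rw [BasedComplex.connecting_neg_one_eq hκm, hfm, one_mul, red_foldOdd_sq hA, hl₀]
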